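/- Let $d\ge 2$ be an integer, let $\varkappa>0$ and $\gamma>0$, and let $\mathbb{H}^d(\varkappa)$ be the $d$-dimensional hyperbolic space of constant sectional curvature $-\varkappa$, with metric $d_\varkappa$ and $d$-dimensional Hausdorff measure $\mathcal{H}^d_\varkappa$ (normalised so that it is the Riemannian volume). Let $\eta$ be a stationary Poisson process on $\mathbb{H}^d(\varkappa)$ of intensity $\gamma$, that is, a random locally finite subset such that for every Borel set $B$ the number $|\eta\cap B|$ is Poisson distributed with mean $\gamma\,\mathcal{H}^d_\varkappa(B)$, and such that for pairwise disjoint Borel sets $B_1,\dots,B_k$ the random variables $|\eta\cap B_1|,\dots,|\eta\cap B_k|$ are independent. Fix a point $o\in\mathbb{H}^d(\varkappa)$. The radial spanning tree of $\eta$ is the graph with vertex set $\eta\cup\{o\}$ in which every vertex $x\neq o$ is joined by an edge to its radial nearest neighbour, i.e. to the vertex $y$ with $d_\varkappa(o,y)<d_\varkappa(o,x)$ that has minimal distance $d_\varkappa(x,y)$ to $x$. Let $\deg(o)\in\{0,1,2,\dots\}\cup\{\infty\}$ be the degree of $o$ in this graph, a random variable. For $k\in\mathbb{N}$ put $\omega_k=2\pi^{k/2}/\Gamma(k/2)$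 and $\kappa_k=\omega_k/k$. Then: (a) $\mathbb{E}[\deg(o)^n]<\infty$ for every $n\in\mathbb{N}$. (b) The expected degree is given by $$\mathbb{E}[\deg(o)]=\gamma\,\omega_d\,\varkappa^{-d/2}\int_0^\infty \sinh^{d-1}(r)\,\exp\!\left(-2\gamma\,\kappa_{d-1}\,\varkappa^{-d/2}\int_0^{r/2}\left[\frac{\cosh^2(r)}{\cosh^2(r-t)}-1\right]^{\frac{d-1}{2}}\mathrm{d}t\right)\mathrm{d}r,$$ where the outer integral is finite. (c) The degree of the origin is not almost surely bounded: $\mathbb{P}(\deg(o)\ge n)>0$ for every $n\in\mathbb{N}$. -/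

import Mathlib

open MeasureTheory ProbabilityTheory
open scoped ENNReal NNReal

noncomputable section

/-! ### Hyperbolic space: the upper half-space model -/

/-- The underlying set of the `d`-dimensional hyperbolic space of constant curvature `-ϰ`, in the
upper half-space model: the points of `ℝ^d` whose last coordinate is positive. -/
@[ext]
structure HyperbolicSpace (d : ℕ) [NeZero d] (ϰ : ℝ) where
  /-- the underlying point of `ℝ^d` -/
  point : EuclideanSpace ℝ (Fin d)
  height_pos' : 0 < point ⟨d - 1, Nat.sub_one_lt (NeZero.ne d)⟩

namespace HyperbolicSpace

variable {d : ℕ} [NeZero d] {ϰ : ℝ}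

/-- The last coordinate. -/
def height (x : HyperbolicSpace d ϰ) : ℝ := x.point ⟨d - 1, Nat.sub_one_lt (NeZero.ne d)⟩

theorem height_pos (x : HyperbolicSpace d ϰ) : 0 < x.height := x.height_pos'

/-- The Riemannian distance of the metric `ϰ⁻¹ (dx₁² + ⋯ + dx_d²) / x_d²`. -/
instance : Dist (HyperbolicSpace d ϰ) where
  dist x y := 1 / √ϰ * Real.arcosh (1 + ‖x.point - y.point‖ ^ 2 / (2 * x.height * y.height))

/-- The distance for `ϰ = 1`. -/
def unitDist (x y : HyperbolicSpace d ϰ) : ℝ :=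
  Real.arcosh (1 + ‖x.point - y.point‖ ^ 2 / (2 * x.height * y.height))

theorem dist_def (x y : HyperbolicSpace d ϰ) : dist x y = 1 / √ϰ * unitDist x y := rfl

theorem one_le_arg (x y : HyperbolicSpace d ϰ) :
    1 ≤ 1 + ‖x.point - y.point‖ ^ 2 / (2 * x.height * y.height) := by
  have := x.height_pos
  have := y.height_pos
  have : 0 ≤ ‖x.point - y.point‖ ^ 2 / (2 * x.height * y.height) := by positivity
  linarith

theorem unitDist_nonneg (x y : HyperbolicSpace d ϰ) : 0 ≤ unitDist x y :=
  Real.arcosh_nonneg (one_le_arg x y)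

theorem sinh_half_unitDist (x y : HyperbolicSpace d ϰ) :
    Real.sinh (unitDist x y / 2) = ‖x.point - y.point‖ / (2 * √(x.height * y.height)) := by
  have hx := x.height_pos
  have hy := y.height_pos
  have h1 : Real.cosh (unitDist x y) =
      1 + ‖x.point - y.point‖ ^ 2 / (2 * x.height * y.height) :=
    Real.cosh_arcosh (one_le_arg x y)
  have h2 : Real.cosh (unitDist x y) = 1 + 2 * Real.sinh (unitDist x y / 2) ^ 2 := by
    have h3 := Real.cosh_two_mul (unitDist x y / 2)
    rw [mul_div_cancel₀ _ (two_ne_zero)] at h3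
    rw [h3, Real.cosh_sq]; ring
  have h4 : 0 ≤ Real.sinh (unitDist x y / 2) :=
    Real.sinh_nonneg_iff.2 (by have := unitDist_nonneg x y; linarith)
  rw [← pow_left_inj₀ h4 (by positivity) two_ne_zero, div_pow, mul_pow,
    Real.sq_sqrt (by positivity)]
  have h5 : 2 * Real.sinh (unitDist x y / 2) ^ 2 =
      ‖x.point - y.point‖ ^ 2 / (2 * x.height * y.height) := by linarith
  have h6 : Real.sinh (unitDist x y / 2) ^ 2 =
      (‖x.point - y.point‖ ^ 2 / (2 * x.height * y.height)) / 2 := by linarith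
  rw [h6]; field_simp

/-- The Euclidean reflection of a point at the boundary hyperplane. -/
def reflected (y : HyperbolicSpace d ϰ) : EuclideanSpace ℝ (Fin d) :=
  y.point - EuclideanSpace.single ⟨d - 1, Nat.sub_one_lt (NeZero.ne d)⟩ (2 * y.height)

theorem norm_sub_reflected_sq (x y : HyperbolicSpace d ϰ) :
    ‖x.point - y.reflected‖ ^ 2 = ‖x.point - y.point‖ ^ 2 + 4 * x.height * y.height := by
  have h : x.point - y.reflected = (x.point - y.point) +
      EuclideanSpace.single ⟨d - 1, Nat.sub_one_lt (NeZero.ne d)⟩ (2 * y.height) := by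
    rw [reflected]; abel
  rw [h, norm_add_sq_real, EuclideanSpace.inner_single_right]
  simp only [PiLp.norm_single, Real.norm_eq_abs, sq_abs, PiLp.sub_apply, conj_trivial]
  change _ + 2 * (2 * y.height * (x.height - y.height)) + _ = _
  ring

theorem cosh_half_unitDist (x y : HyperbolicSpace d ϰ) :
    Real.cosh (unitDist x y / 2) = ‖x.point - y.reflected‖ / (2 * √(x.height * y.height)) := by
  have hx := x.height_pos
  have hy := y.height_pos
  rw [← pow_left_inj₀ (Real.cosh_pos _).le (by positivity) two_ne_zero, Real.cosh_sq,
    sinh_half_unitDist, div_pow, div_pow, mul_pow, Real.sq_sqrt (by positivity),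
    norm_sub_reflected_sq]
  field_simp
  ring

theorem unitDist_triangle (x y z : HyperbolicSpace d ϰ) :
    unitDist x z ≤ unitDist x y + unitDist y z := by
  have hx := x.height_pos
  have hy := y.height_pos
  have hz := z.height_pos
  suffices h : unitDist x z / 2 ≤ unitDist x y / 2 + unitDist y z / 2 by linarith
  rw [← Real.sinh_le_sinh, Real.sinh_add, sinh_half_unitDist, sinh_half_unitDist,
    sinh_half_unitDist, cosh_half_unitDist, cosh_half_unitDist]
  have hpt := EuclideanGeometry.mul_dist_le_mul_dist_add_mul_dist
    x.point y.point z.point y.reflected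
  have hyy : dist y.point y.reflected = 2 * y.height := by
    rw [dist_eq_norm, ← pow_left_inj₀ (norm_nonneg _) (by positivity) two_ne_zero,
      norm_sub_reflected_sq]
    simp; ring
  have hzy : dist z.point y.reflected = ‖y.point - z.reflected‖ := by
    rw [dist_eq_norm, ← pow_left_inj₀ (norm_nonneg _) (norm_nonneg _) two_ne_zero,
      norm_sub_reflected_sq, norm_sub_reflected_sq, norm_sub_rev]
    ring
  rw [hyy, hzy, dist_eq_norm, dist_eq_norm, dist_eq_norm, dist_eq_norm] at hpt
  rw [Real.sqrt_mul hx.le, Real.sqrt_mul hx.le, Real.sqrt_mul hy.le]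
  have sx := Real.sqrt_pos.2 hx
  have sy := Real.sqrt_pos.2 hy
  have sz := Real.sqrt_pos.2 hz
  have e : ‖x.point - y.point‖ / (2 * (√x.height * √y.height)) *
        (‖y.point - z.reflected‖ / (2 * (√y.height * √z.height))) +
      ‖x.point - y.reflected‖ / (2 * (√x.height * √y.height)) *
        (‖y.point - z.point‖ / (2 * (√y.height * √z.height))) =
      (‖x.point - y.point‖ * ‖y.point - z.reflected‖ +
        ‖y.point - z.point‖ * ‖x.point - y.reflected‖) /
        (4 * y.height * (√x.height * √z.height)) := by
    have hs : 4 * y.height = 4 * (√y.height * √y.height) := by rw [Real.mul_self_sqrt hy.le]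
    rw [hs]
    field_simp
    ring
  rw [e, div_le_div_iff₀ (by positivity) (by positivity)]
  have := mul_le_mul_of_nonneg_right hpt (by positivity : 0 ≤ 2 * (√x.height * √z.height))
  linarith

instance [Fact (0 < ϰ)] : MetricSpace (HyperbolicSpace d ϰ) where
  dist_self x := by
    rw [dist_def, unitDist]; simp
  dist_comm x y := by
    rw [dist_def, dist_def, unitDist, unitDist, norm_sub_rev, mul_right_comm]
  dist_triangle x y z := by
    rw [dist_def, dist_def, dist_def, ← mul_add]
    exact mul_le_mul_of_nonneg_left (unitDist_triangle x y z) (by positivity)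
  eq_of_dist_eq_zero {x y} h := by
    have hϰ : 0 < ϰ := Fact.out
    have hx := x.height_pos
    have hy := y.height_pos
    rw [dist_def, mul_eq_zero] at h
    have h0 : unitDist x y = 0 := h.resolve_left (by positivity)
    have h1 := sinh_half_unitDist x y
    rw [h0, zero_div, Real.sinh_zero, eq_comm, div_eq_zero_iff] at h1
    exact HyperbolicSpace.ext (sub_eq_zero.1 (norm_eq_zero.1 (h1.resolve_right (by positivity))))

instance [Fact (0 < ϰ)] : MeasurableSpace (HyperbolicSpace d ϰ) := borel _

instance [Fact (0 < ϰ)] : BorelSpace (HyperbolicSpace d ϰ) := ⟨rfl⟩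

end HyperbolicSpace

/-- The `d`-dimensional Hausdorff measure of `ℍ^d(ϰ)` for the hyperbolic metric, with the usual
normalisation (the one for which it is Lebesgue measure on Euclidean `ℝ^d`). -/
def hyperbolicVolume (d : ℕ) [NeZero d] (ϰ : ℝ) [Fact (0 < ϰ)] : Measure (HyperbolicSpace d ϰ) :=
  Measure.euclideanHausdorffMeasure d

/-! ### Poisson processes -/

/-- The Poisson distribution on `ℕ ∪ {∞}` with mean `m ∈ [0, ∞]`; for `m = ∞` it is concentrated
in `∞`. -/
def poissonLaw (m : ℝ≥0∞) : Measure ℕ∞ :=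
  if m = ∞ then Measure.dirac ⊤ else (poissonMeasure m.toNNReal).map (fun n : ℕ => (n : ℕ∞))

/-- `η` is a Poisson process with intensity measure `μ` on the metric space `X`: a random locally
finite set such that the number of points in a Borel set `B` is a Poisson random variable with mean
`μ B`, and the numbers of points in disjoint Borel sets are independent. -/
structure IsPoissonProcess {Ω X : Type*} [MeasurableSpace Ω] [MetricSpace X] [MeasurableSpace X]
    (η : Ω → Set X) (μ : Measure X) (P : Measure Ω) : Prop where
  locallyFinite : ∀ ω, ∀ B : Set X, Bornology.IsBounded B → (η ω ∩ B).Finite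
  measurable_count : ∀ B : Set X, MeasurableSet B → Measurable fun ω => (η ω ∩ B).encard
  law_count : ∀ B : Set X, MeasurableSet B → P.map (fun ω => (η ω ∩ B).encard) = poissonLaw (μ B)
  indep_count : ∀ (k : ℕ) (B : Fin k → Set X), (∀ i, MeasurableSet (B i)) →
    Pairwise (Function.onFun Disjoint B) → iIndepFun (fun i ω => (η ω ∩ B i).encard) P

/-! ### The radial spanning tree -/

section RadialSpanningTree

variable {X : Type*} [MetricSpace X]

/-- `y` is a radial nearest neighbour of `x`: among the vertices (the points of `ξ ∪ {o}`) that are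
strictly closer to `o` than `x` is, `y` has minimal distance to `x`. -/
def IsRadialNearestNeighbour (o : X) (ξ : Set X) (x y : X) : Prop :=
  y ∈ insert o ξ ∧ dist o y < dist o x ∧
    ∀ z ∈ insert o ξ, dist o z < dist o x → dist x y ≤ dist x z

/-- The radial spanning tree on `ξ` with base point `o`: the graph with vertex set `ξ ∪ {o}` in
which every vertex other than `o` is joined to its radial nearest neighbour. (The vertex `o` has no
radial nearest neighbour, since no point is closer to `o` than `o` itself.) -/
def radialSpanningTree (o : X) (ξ : Set X) : SimpleGraph ↥(insert o ξ) where
  Adj x y := IsRadialNearestNeighbour o ξ x y ∨ IsRadialNearestNeighbour o ξ y x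
  symm := ⟨fun _ _ h => h.symm⟩
  loopless := ⟨fun _ h => h.elim (fun h => lt_irrefl _ h.2.1) (fun h => lt_irrefl _ h.2.1)⟩

/-- The degree of the origin in the radial spanning tree on `ξ`, possibly infinite. -/
def originDegree (o : X) (ξ : Set X) : ℕ∞ :=
  ((radialSpanningTree o ξ).neighborSet ⟨o, Set.mem_insert o ξ⟩).encard

end RadialSpanningTree

/-! ### Constants -/

/-- `ω_k = 2 π^{k/2} / Γ(k/2)`, the surface content of the unit sphere of `ℝ^k`. -/
def unitSphereArea (k : ℕ) : ℝ := 2 * Real.pi ^ ((k : ℝ) / 2) / Real.Gamma ((k : ℝ) / 2)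

/-- `κ_k = ω_k / k`, the volume of the unit ball of `ℝ^k`. -/
def unitBallVolume (k : ℕ) : ℝ := unitSphereArea k / k

/-- The integrand (as a function of `r`) of the formula for the expected degree of the origin. -/
def expectedDegreeIntegrand (d : ℕ) (ϰ γ r : ℝ) : ℝ :=
  Real.sinh r ^ (d - 1) *
    Real.exp (-(2 * γ * unitBallVolume (d - 1) * ϰ ^ (-(d : ℝ) / 2) *
      ∫ t in (0 : ℝ)..(r / 2),
        (Real.cosh r ^ 2 / Real.cosh (r - t) ^ 2 - 1) ^ (((d : ℝ) - 1) / 2)))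

end

/-!
A point `x ≠ o` of `η` is joined to `o` exactly if the lens of points closer than `x` to `o` and
closer than `o` to `x` contains no point of `η`. Approximating by partitions with shrinking cells,
whose counts are independent of the counts in the lenses, shows that the expected number of such `x`
in a Borel set is the integral of `exp (-μ (lens o x))` over it, where `μ` is the intensity measure.
The isometry of the half-space model with the hyperboloid, together with polar coordinates around
`o`, turns this into the formula for the expected degree.

The volume of the lens grows at least quadratically in the distance `r` of `x` and `o`, whereas
`μ (ball o r)` grows exponentially. Hence the integral of `a ^ r * exp (-μ (lens o x))` is finite
for every `a`. This controls the moments: the `n`-th power of the degree is at most the sum over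
the shells `k ≤ r < k + 1` of `a⁻ᵏ * |η ∩ ball o (k + 1)| ^ (2 n + 1)`, whose expectation decays
geometrically in `k` if `a` is large, plus `aᵏ` times the number of neighbours of `o` in the shell.

For points whose mutual distances exceed their distances to `o` it has positive probability that
each of them has a point of `η` nearby and that no other point of `η` interferes; all of these are
then joined to `o`.
-/

/-! ### The Poisson law on `ℕ∞` -/

instance isProbabilityMeasure_poissonLaw (m : ℝ≥0∞) : IsProbabilityMeasure (poissonLaw m) := by
  rw [poissonLaw]
  split_ifs
  · infer_instance
  · exact Measure.isProbabilityMeasure_map .of_discrete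

theorem lintegral_poissonLaw {m : ℝ≥0∞} (hm : m ≠ ∞) (f : ℕ∞ → ℝ≥0∞) :
    ∫⁻ x, f x ∂poissonLaw m =
      ∑' n : ℕ, ENNReal.ofReal (Real.exp (-m.toReal) * m.toReal ^ n / n.factorial) * f n := by
  rw [poissonLaw, if_neg hm, lintegral_map .of_discrete .of_discrete, poissonMeasure,
    lintegral_sum_measure]
  refine tsum_congr fun n => ?_
  rw [lintegral_smul_measure, lintegral_dirac]
  rfl

theorem ofReal_poisson_weight_succ_mul {m : ℝ≥0∞} (hm : m ≠ ∞) (n : ℕ) :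
    ENNReal.ofReal (Real.exp (-m.toReal) * m.toReal ^ (n + 1) / (n + 1).factorial) * (n + 1 : ℕ) =
      m * ENNReal.ofReal (Real.exp (-m.toReal) * m.toReal ^ n / n.factorial) := by
  nth_rw 3 [← ENNReal.ofReal_toReal hm]
  rw [← ENNReal.ofReal_natCast, ← ENNReal.ofReal_mul (by positivity),
    ← ENNReal.ofReal_mul (by positivity), Nat.factorial_succ]
  congr 1
  push_cast
  field_simp
  ring

theorem lintegral_poissonLaw_mul {m : ℝ≥0∞} (hm : m ≠ ∞) (f : ℕ∞ → ℝ≥0∞) :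
    ∫⁻ x, (x : ℝ≥0∞) * f x ∂poissonLaw m = m * ∫⁻ x, f (x + 1) ∂poissonLaw m := by
  rw [lintegral_poissonLaw hm, lintegral_poissonLaw hm, tsum_eq_zero_add' ENNReal.summable,
    ← ENNReal.tsum_mul_left]
  simp only [Nat.cast_zero, ENat.toENNReal_zero, zero_mul, mul_zero, zero_add]
  refine tsum_congr fun n => ?_
  rw [ENat.toENNReal_coe, ← mul_assoc, ofReal_poisson_weight_succ_mul hm, mul_assoc]
  push_cast
  rfl

theorem lintegral_poissonLaw_id {m : ℝ≥0∞} (hm : m ≠ ∞) :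
    ∫⁻ x, (x : ℝ≥0∞) ∂poissonLaw m = m := by
  simpa using lintegral_poissonLaw_mul hm fun _ => 1

theorem poissonLaw_singleton_zero {m : ℝ≥0∞} (hm : m ≠ ∞) :
    poissonLaw m {0} = ENNReal.ofReal (Real.exp (-m.toReal)) := by
  rw [← lintegral_indicator_one (measurableSet_singleton _), lintegral_poissonLaw hm,
    tsum_eq_single 0]
  · simp
  · intro n hn
    simp [hn]

theorem poissonLaw_singleton_zero_pos {m : ℝ≥0∞} (hm : m ≠ ∞) : 0 < poissonLaw m {0} := by
  simp [poissonLaw_singleton_zero hm, Real.exp_pos]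

theorem poissonLaw_singleton_zero_compl_pos {m : ℝ≥0∞} (hm : m ≠ 0) : 0 < poissonLaw m {0}ᶜ := by
  by_cases h : m = ∞
  · simp [poissonLaw, h]
  rw [prob_compl_eq_one_sub (measurableSet_singleton _), poissonLaw_singleton_zero h,
    tsub_pos_iff_lt, ENNReal.ofReal_lt_one, Real.exp_lt_one_iff]
  simpa using ENNReal.toReal_pos hm h

theorem tendsto_poissonLaw_singleton_zero {ι : Type*} {l : Filter ι} {m : ι → ℝ≥0∞} {a : ℝ≥0∞}
    (ha : a ≠ ∞) (h : Filter.Tendsto m l (nhds a)) :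
    Filter.Tendsto (fun i => poissonLaw (m i) {0}) l (nhds (poissonLaw a {0})) := by
  have hlim : Filter.Tendsto (fun i => ENNReal.ofReal (Real.exp (-(m i).toReal))) l
      (nhds (ENNReal.ofReal (Real.exp (-a.toReal)))) :=
    ENNReal.tendsto_ofReal ((Real.continuous_exp.tendsto _).comp
      ((ENNReal.tendsto_toReal ha).comp h).neg)
  rw [poissonLaw_singleton_zero ha]
  exact hlim.congr' ((h.eventually_ne ha).mono fun i hi => (poissonLaw_singleton_zero hi).symm)

theorem add_one_pow_le_two_pow_mul (x : ℝ≥0∞) (p : ℕ) : (x + 1) ^ p ≤ 2 ^ p * (x ^ p + 1) := by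
  have hmax : max x 1 ^ p ≤ x ^ p + 1 := by
    rcases le_total x 1 with hx | hx
    · simp [max_eq_right hx]
    · simp [max_eq_left hx]
  calc (x + 1) ^ p ≤ (2 * max x 1) ^ p := by
        rw [two_mul]
        gcongr
        · exact le_max_left ..
        · exact le_max_right ..
    _ ≤ 2 ^ p * (x ^ p + 1) := by
        rw [mul_pow]
        gcongr

theorem exists_lintegral_pow_poissonLaw_le (p : ℕ) :
    ∃ C : ℝ≥0∞, C ≠ ∞ ∧ ∀ m : ℝ≥0∞, m ≠ ∞ →
      ∫⁻ x, (x : ℝ≥0∞) ^ p ∂poissonLaw m ≤ C * (m + 1) ^ p := by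
  induction p with
  | zero => exact ⟨1, by simp, fun m _ => by simp⟩
  | succ p ih =>
    obtain ⟨C, hC, h⟩ := ih
    refine ⟨2 ^ p * (C + 1), by finiteness, fun m hm => ?_⟩
    have hshift : ∫⁻ x, ((x + 1 : ℕ∞) : ℝ≥0∞) ^ p ∂poissonLaw m ≤
        2 ^ p * (C * (m + 1) ^ p + 1) := by
      calc _ ≤ ∫⁻ x, 2 ^ p * ((x : ℝ≥0∞) ^ p + 1) ∂poissonLaw m :=
            lintegral_mono fun x => by simpa using add_one_pow_le_two_pow_mul (x : ℝ≥0∞) p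
        _ = 2 ^ p * (∫⁻ x, (x : ℝ≥0∞) ^ p ∂poissonLaw m + 1) := by
            rw [lintegral_const_mul _ .of_discrete, lintegral_add_right _ .of_discrete,
              lintegral_one, measure_univ]
        _ ≤ _ := by gcongr; exact h m hm
    calc ∫⁻ x, (x : ℝ≥0∞) ^ (p + 1) ∂poissonLaw m
        = m * ∫⁻ x, ((x + 1 : ℕ∞) : ℝ≥0∞) ^ p ∂poissonLaw m := by
          rw [← lintegral_poissonLaw_mul hm fun x => (x : ℝ≥0∞) ^ p]
          simp_rw [pow_succ']
      _ ≤ (m + 1) * (2 ^ p * (C * (m + 1) ^ p + (m + 1) ^ p)) := by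
          gcongr
          · exact le_self_add
          · refine hshift.trans ?_
            gcongr
            exact one_le_pow₀ le_add_self
      _ = 2 ^ p * (C + 1) * (m + 1) ^ (p + 1) := by ring

/-! ### Points with void influence sets -/

section VoidPoints

open Filter Topology

/-- The points `x` of `ξ` whose influence set `U x` contains no point of `ξ`. -/
def voidPoints {X : Type*} (U : X → Set X) (ξ : Set X) : Set X := {x ∈ ξ | ξ ∩ U x = ∅}

theorem voidPoints_subset {X : Type*} (U : X → Set X) (ξ : Set X) : voidPoints U ξ ⊆ ξ :=
  fun _ hx => hx.1

/-- A sequence of countable Borel partitions of `X` whose cells shrink to the points of `X`. A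
partition is encoded by the map sending a point to the index of its cell. -/
structure IsShrinkingPartition {X : Type*} [TopologicalSpace X] [MeasurableSpace X]
    (cell : ℕ → X → ℕ) : Prop where
  measurable : ∀ n, Measurable (cell n)
  eventually_subset : ∀ x, ∀ s ∈ 𝓝 x, ∀ᶠ n in atTop, cell n ⁻¹' {cell n x} ⊆ s

theorem exists_isShrinkingPartition (X : Type*) [PseudoMetricSpace X]
    [TopologicalSpace.SeparableSpace X] [MeasurableSpace X] [OpensMeasurableSpace X] :
    ∃ cell : ℕ → X → ℕ, IsShrinkingPartition cell := by
  classical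
  rcases isEmpty_or_nonempty X with hX | hX
  · exact ⟨fun _ _ => 0, fun _ => measurable_const, fun x => hX.elim x⟩
  let u := TopologicalSpace.denseSeq X
  have hnear (n : ℕ) (x : X) : ∃ i, dist x (u i) < 1 / ((n : ℝ) + 1) :=
    (TopologicalSpace.denseRange_denseSeq X).exists_dist_lt x (by positivity)
  refine ⟨fun n x => Nat.find (hnear n x), fun n => measurable_find _ fun i =>
    (isOpen_lt (by fun_prop) continuous_const).measurableSet, fun x s hs => ?_⟩
  obtain ⟨ε, hε, hball⟩ := Metric.mem_nhds_iff.1 hs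
  filter_upwards [tendsto_one_div_add_atTop_nhds_zero_nat.eventually_lt_const (half_pos hε)]
    with n hn y hy
  have hx := Nat.find_spec (hnear n x)
  have hy' := Nat.find_spec (hnear n y)
  rw [show Nat.find (hnear n y) = Nat.find (hnear n x) from hy] at hy'
  refine hball (Metric.mem_ball.2 ?_)
  linarith [dist_triangle_right y x (u (Nat.find (hnear n x)))]

section InnerSet

variable {X : Type*} [TopologicalSpace X] {U : X → Set X}

/-- The largest open set that is contained in the influence sets of all points of `s`. -/
def innerInfluence (U : X → Set X) (s : Set X) : Set X := interior (⋂ x ∈ s, U x)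

theorem isOpen_innerInfluence (U : X → Set X) (s : Set X) : IsOpen (innerInfluence U s) :=
  isOpen_interior

theorem innerInfluence_subset {s : Set X} {x : X} (hx : x ∈ s) : innerInfluence U s ⊆ U x :=
  interior_subset.trans (Set.biInter_subset_of_mem hx)

theorem isOpen_influence (hU : IsOpen {p : X × X | p.2 ∈ U p.1}) (x : X) : IsOpen (U x) :=
  hU.preimage (Continuous.prodMk_right x)

variable [MeasurableSpace X] {cell : ℕ → X → ℕ}

theorem IsShrinkingPartition.eventually_mem_innerInfluence (hcell : IsShrinkingPartition cell)
    (hU : IsOpen {p : X × X | p.2 ∈ U p.1}) {x z : X} (hz : z ∈ U x) :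
    ∀ᶠ n in atTop, z ∈ innerInfluence U (cell n ⁻¹' {cell n x}) := by
  obtain ⟨s, hs, t, ht, hst⟩ := mem_nhds_prod_iff.1 (hU.mem_nhds (x := (x, z)) hz)
  filter_upwards [hcell.eventually_subset x s hs] with n hn
  refine mem_interior_iff_mem_nhds.2 (mem_of_superset ht fun w hw => ?_)
  exact Set.mem_iInter₂.2 fun y hy => hst (Set.mk_mem_prod (hn hy) hw)

theorem IsShrinkingPartition.eventually_inter_innerInfluence_eq_empty_iff
    (hcell : IsShrinkingPartition cell) (hU : IsOpen {p : X × X | p.2 ∈ U p.1})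
    (ξ : Set X) (x : X) :
    ∀ᶠ n in atTop,
      (ξ ∩ innerInfluence U (cell n ⁻¹' {cell n x}) = ∅ ↔ ξ ∩ U x = ∅) := by
  rcases (ξ ∩ U x).eq_empty_or_nonempty with h | ⟨z, hzξ, hz⟩
  · refine .of_forall fun n => iff_of_true (Set.subset_eq_empty ?_ h) h
    exact Set.inter_subset_inter_right _ (innerInfluence_subset rfl)
  · filter_upwards [hcell.eventually_mem_innerInfluence hU hz] with n hn
    exact iff_of_false (Set.Nonempty.ne_empty ⟨z, hzξ, hn⟩) (Set.Nonempty.ne_empty ⟨z, hzξ, hz⟩)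

theorem IsShrinkingPartition.tendsto_measure_innerInfluence [OpensMeasurableSpace X]
    (hcell : IsShrinkingPartition cell) (hU : IsOpen {p : X × X | p.2 ∈ U p.1}) {μ : Measure X}
    {x : X} (hμ : μ (U x) ≠ ∞) :
    Tendsto (fun n => μ (innerInfluence U (cell n ⁻¹' {cell n x}))) atTop (𝓝 (μ (U x))) := by
  refine tendsto_measure_of_tendsto_indicator atTop
    (fun n => (isOpen_innerInfluence U _).measurableSet) (isOpen_influence hU x).measurableSet hμ
    (.of_forall fun n => innerInfluence_subset rfl) fun z => ?_
  by_cases hz : z ∈ U x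
  · exact (hcell.eventually_mem_innerInfluence hU hz).mono fun n hn => iff_of_true hn hz
  · exact .of_forall fun n => iff_of_false (fun h => hz
      (innerInfluence_subset (s := cell n ⁻¹' {cell n x}) rfl h)) hz

end InnerSet

theorem tsum_encard_inter_fiber_mul {X : Type*} {S : Set X} (hS : S.Finite) (cell : X → ℕ)
    (a : ℕ → ℝ≥0∞) :
    ∑' i, ((S ∩ cell ⁻¹' {i}).encard : ℝ≥0∞) * a i = ∑ x ∈ hS.toFinset, a (cell x) := by
  classical
  have hterm (i : ℕ) : ((S ∩ cell ⁻¹' {i}).encard : ℝ≥0∞) * a i =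
      ∑ x ∈ hS.toFinset, if i = cell x then a i else 0 := by
    have hfilter : S ∩ cell ⁻¹' {i} = (hS.toFinset.filter fun x => i = cell x : Finset X) := by
      ext x
      simp [eq_comm]
    rw [hfilter, Set.encard_coe_eq_coe_finsetCard, ← Finset.sum_filter, Finset.sum_const,
      nsmul_eq_mul, ENat.toENNReal_coe]
  simp_rw [hterm]
  rw [Summable.tsum_finsetSum fun _ _ => ENNReal.summable]
  simp only [tsum_ite_eq]

theorem encard_voidPoints_inter {X : Type*} (U : X → Set X) {ξ A : Set X}
    (hS : (ξ ∩ A).Finite) :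
    ((voidPoints U ξ ∩ A).encard : ℝ≥0∞) =
      ∑ x ∈ hS.toFinset, Set.indicator {0} 1 (ξ ∩ U x).encard := by
  classical
  have hfilter : voidPoints U ξ ∩ A =
      (hS.toFinset.filter fun x => ξ ∩ U x = ∅ : Finset X) := by
    ext x
    simp only [voidPoints, Set.mem_inter_iff, Set.mem_ofPred_eq, Finset.coe_filter,
      Set.Finite.mem_toFinset]
    tauto
  rw [hfilter, Set.encard_coe_eq_coe_finsetCard, Finset.card_filter]
  simp [Set.indicator_apply]

section CellVoidCount

variable {X : Type*} [TopologicalSpace X] {U : X → Set X}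

/-- The discretised count of `voidPoints U ξ ∩ A`: a point of `ξ ∩ A` is counted if the inner
influence set of its whole cell contains no point of `ξ`. -/
noncomputable def cellVoidCount (U : X → Set X) (A : Set X) (cell : X → ℕ) (ξ : Set X) : ℝ≥0∞ :=
  ∑' i, ((ξ ∩ (A ∩ cell ⁻¹' {i})).encard : ℝ≥0∞) *
    Set.indicator {0} 1 (ξ ∩ innerInfluence U (cell ⁻¹' {i})).encard

theorem cellVoidCount_eq_sum (U : X → Set X) {A ξ : Set X} (hS : (ξ ∩ A).Finite) (cell : X → ℕ) :
    cellVoidCount U A cell ξ = ∑ x ∈ hS.toFinset,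
      Set.indicator {0} 1 (ξ ∩ innerInfluence U (cell ⁻¹' {cell x})).encard := by
  simp_rw [cellVoidCount, ← Set.inter_assoc]
  exact tsum_encard_inter_fiber_mul hS cell _

theorem cellVoidCount_le (U : X → Set X) {A ξ : Set X} (hS : (ξ ∩ A).Finite) (cell : X → ℕ) :
    cellVoidCount U A cell ξ ≤ (ξ ∩ A).encard := by
  rw [cellVoidCount_eq_sum U hS, hS.encard_eq_coe_toFinset_card, ENat.toENNReal_coe,
    Finset.card_eq_sum_ones, Nat.cast_sum, Nat.cast_one]
  exact Finset.sum_le_sum fun x _ => Set.indicator_le_self' (fun _ _ => zero_le) _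

theorem IsShrinkingPartition.tendsto_cellVoidCount [MeasurableSpace X] {cell : ℕ → X → ℕ}
    (hcell : IsShrinkingPartition cell) (hU : IsOpen {p : X × X | p.2 ∈ U p.1}) {A ξ : Set X}
    (hS : (ξ ∩ A).Finite) :
    Tendsto (fun n => cellVoidCount U A (cell n) ξ) atTop
      (𝓝 ((voidPoints U ξ ∩ A).encard : ℝ≥0∞)) := by
  simp_rw [cellVoidCount_eq_sum U hS, encard_voidPoints_inter U hS]
  refine tendsto_finsetSum _ fun x _ => Tendsto.congr' ?_ tendsto_const_nhds
  filter_upwards [hcell.eventually_inter_innerInfluence_eq_empty_iff hU ξ x] with n hn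
  simp only [Set.indicator_apply, Set.mem_singleton_iff, Set.encard_eq_zero, Pi.one_apply, hn]

end CellVoidCount

end VoidPoints

namespace IsPoissonProcess

open Filter Topology

variable {Ω X : Type*} [MeasurableSpace Ω] [MetricSpace X] [MeasurableSpace X]
  {η : Ω → Set X} {μ : Measure X} {P : Measure Ω}

theorem isProbabilityMeasure (hη : IsPoissonProcess η μ P) : IsProbabilityMeasure P := by
  have hmap : P.map (fun ω => (η ω ∩ ∅).encard) Set.univ = 1 := by
    rw [hη.law_count ∅ .empty, measure_univ]
  exact ⟨by rwa [Measure.map_apply (hη.measurable_count ∅ .empty) .univ] at hmap⟩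

theorem measure_ne_top_of_isBounded [OpensMeasurableSpace X] (hη : IsPoissonProcess η μ P)
    {B : Set X} (hB : Bornology.IsBounded B) : μ B ≠ ∞ := by
  refine measure_ne_top_of_subset subset_closure fun h => ?_
  have hclosure : MeasurableSet (closure B) := isClosed_closure.measurableSet
  have htop : P.map (fun ω => (η ω ∩ closure B).encard) {⊤} = 1 := by
    rw [hη.law_count _ hclosure, poissonLaw, if_pos h]
    simp
  rw [Measure.map_apply (hη.measurable_count _ hclosure) (measurableSet_singleton _),
    show (fun ω => (η ω ∩ closure B).encard) ⁻¹' {⊤} = ∅ from Set.eq_empty_of_forall_notMem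
      fun ω hω => (hη.locallyFinite ω _ hB.closure).encard_lt_top.ne hω] at htop
  simp at htop

theorem measurable_toENNReal_count (hη : IsPoissonProcess η μ P) {B : Set X}
    (hB : MeasurableSet B) : Measurable fun ω => ((η ω ∩ B).encard : ℝ≥0∞) :=
  (Measurable.of_discrete (f := fun n : ℕ∞ => (n : ℝ≥0∞))).comp (hη.measurable_count B hB)

theorem measurable_void_indicator (hη : IsPoissonProcess η μ P) {B : Set X}
    (hB : MeasurableSet B) :
    Measurable fun ω => Set.indicator {0} (1 : ℕ∞ → ℝ≥0∞) (η ω ∩ B).encard :=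
  (Measurable.of_discrete (f := Set.indicator {0} (1 : ℕ∞ → ℝ≥0∞))).comp
    (hη.measurable_count B hB)

theorem lintegral_comp_count (hη : IsPoissonProcess η μ P) {B : Set X} (hB : MeasurableSet B)
    (f : ℕ∞ → ℝ≥0∞) : ∫⁻ ω, f (η ω ∩ B).encard ∂P = ∫⁻ n, f n ∂poissonLaw (μ B) := by
  rw [← hη.law_count B hB, lintegral_map .of_discrete (hη.measurable_count B hB)]

theorem lintegral_count (hη : IsPoissonProcess η μ P) {B : Set X} (hB : MeasurableSet B)
    (hμ : μ B ≠ ∞) : ∫⁻ ω, ((η ω ∩ B).encard : ℝ≥0∞) ∂P = μ B := by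
  rw [hη.lintegral_comp_count hB fun n => n, lintegral_poissonLaw_id hμ]

theorem indepFun_count (hη : IsPoissonProcess η μ P) {A B : Set X} (hA : MeasurableSet A)
    (hB : MeasurableSet B) (hAB : Disjoint A B) :
    IndepFun (fun ω => (η ω ∩ A).encard) (fun ω => (η ω ∩ B).encard) P := by
  have hmeas : ∀ i, MeasurableSet (![A, B] i) := by simp [Fin.forall_fin_two, hA, hB]
  have hdisj : Pairwise (Function.onFun Disjoint ![A, B]) := by
    simp [Pairwise, Fin.forall_fin_two, Function.onFun, hAB, hAB.symm]
  have hindep := (hη.indep_count 2 ![A, B] hmeas hdisj).indepFun (zero_ne_one' (Fin 2))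
  simpa only [Matrix.cons_val_zero, Matrix.cons_val_one] using hindep

theorem lintegral_count_mul_void (hη : IsPoissonProcess η μ P) {A B : Set X}
    (hA : MeasurableSet A) (hB : MeasurableSet B) (hAB : Disjoint A B) (hμ : μ A ≠ ∞) :
    ∫⁻ ω, ((η ω ∩ A).encard : ℝ≥0∞) * Set.indicator {0} 1 (η ω ∩ B).encard ∂P =
      μ A * poissonLaw (μ B) {0} := by
  rw [lintegral_mul_eq_lintegral_mul_lintegral_of_indepFun''
    (f := fun ω => ((η ω ∩ A).encard : ℝ≥0∞))
    (g := fun ω => Set.indicator {0} 1 (η ω ∩ B).encard)]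
  · rw [hη.lintegral_count hA hμ, hη.lintegral_comp_count hB,
      lintegral_indicator_one (measurableSet_singleton _)]
  · exact (hη.measurable_toENNReal_count hA).aemeasurable
  · exact (hη.measurable_void_indicator hB).aemeasurable
  · exact (hη.indepFun_count hA hB hAB).comp (φ := fun n : ℕ∞ => (n : ℝ≥0∞))
      (ψ := Set.indicator {0} 1) .of_discrete .of_discrete

section Mecke

variable [OpensMeasurableSpace X] {U : X → Set X}

theorem measurable_cellVoidCount (hη : IsPoissonProcess η μ P) (U : X → Set X) {A : Set X}
    (hA : MeasurableSet A) {cell : X → ℕ} (hcell : Measurable cell) :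
    Measurable fun ω => cellVoidCount U A cell (η ω) :=
  Measurable.tsum fun i =>
    (hη.measurable_toENNReal_count (hA.inter (hcell (measurableSet_singleton i)))).mul
      (hη.measurable_void_indicator (isOpen_innerInfluence U _).measurableSet)

-- A point is not in its own influence set, so a cell is disjoint from its inner influence set and
-- the two counts in each summand are independent.
theorem lintegral_cellVoidCount (hη : IsPoissonProcess η μ P) (hU : ∀ x, x ∉ U x) {A : Set X}
    (hA : MeasurableSet A) (hμ : μ A ≠ ∞) {cell : X → ℕ} (hcell : Measurable cell) :
    ∫⁻ ω, cellVoidCount U A cell (η ω) ∂P =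
      ∫⁻ x in A, poissonLaw (μ (innerInfluence U (cell ⁻¹' {cell x}))) {0} ∂μ := by
  have hfiber (i : ℕ) : MeasurableSet (cell ⁻¹' {i}) := hcell (measurableSet_singleton i)
  have hinner (i : ℕ) : MeasurableSet (innerInfluence U (cell ⁻¹' {i})) :=
    (isOpen_innerInfluence U _).measurableSet
  have hdisj (i : ℕ) : Disjoint (A ∩ cell ⁻¹' {i}) (innerInfluence U (cell ⁻¹' {i})) :=
    Set.disjoint_left.2 fun x hx hxU => hU x (innerInfluence_subset hx.2 hxU)
  have hterm (i : ℕ) : Measurable fun ω => ((η ω ∩ (A ∩ cell ⁻¹' {i})).encard : ℝ≥0∞) *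
      Set.indicator {0} 1 (η ω ∩ innerInfluence U (cell ⁻¹' {i})).encard :=
    (hη.measurable_toENNReal_count (hA.inter (hfiber i))).mul
      (hη.measurable_void_indicator (hinner i))
  simp only [cellVoidCount]
  rw [lintegral_tsum fun i => (hterm i).aemeasurable,
    ← lintegral_map (μ := μ.restrict A)
      (f := fun i => poissonLaw (μ (innerInfluence U (cell ⁻¹' {i}))) {0}) .of_discrete hcell,
    lintegral_countable']
  refine tsum_congr fun i => ?_
  rw [hη.lintegral_count_mul_void (hA.inter (hfiber i)) (hinner i) (hdisj i)
    (measure_ne_top_of_subset Set.inter_subset_left hμ),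
    Measure.map_apply hcell (measurableSet_singleton i),
    Measure.restrict_apply (hfiber i), mul_comm, Set.inter_comm]

variable [TopologicalSpace.SeparableSpace X]

theorem measurable_encard_voidPoints_inter_of_isBounded (hη : IsPoissonProcess η μ P)
    (hU : IsOpen {p : X × X | p.2 ∈ U p.1}) {A : Set X} (hA : MeasurableSet A)
    (hAb : Bornology.IsBounded A) :
    Measurable fun ω => ((voidPoints U (η ω) ∩ A).encard : ℝ≥0∞) := by
  obtain ⟨cell, hcell⟩ := exists_isShrinkingPartition X
  exact measurable_of_tendsto_metrizable
    (fun n => hη.measurable_cellVoidCount U hA (hcell.measurable n))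
    (tendsto_pi_nhds.2 fun ω => hcell.tendsto_cellVoidCount hU (hη.locallyFinite ω A hAb))

theorem lintegral_encard_voidPoints_inter_of_isBounded (hη : IsPoissonProcess η μ P)
    (hU : IsOpen {p : X × X | p.2 ∈ U p.1}) (hself : ∀ x, x ∉ U x)
    (hbdd : ∀ x, Bornology.IsBounded (U x)) {A : Set X} (hA : MeasurableSet A)
    (hAb : Bornology.IsBounded A) :
    ∫⁻ ω, ((voidPoints U (η ω) ∩ A).encard : ℝ≥0∞) ∂P =
      ∫⁻ x in A, poissonLaw (μ (U x)) {0} ∂μ := by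
  obtain ⟨cell, hcell⟩ := exists_isShrinkingPartition X
  have hμA : μ A ≠ ∞ := hη.measure_ne_top_of_isBounded hAb
  have hleft : Tendsto (fun n => ∫⁻ ω, cellVoidCount U A (cell n) (η ω) ∂P) atTop
      (𝓝 (∫⁻ ω, ((voidPoints U (η ω) ∩ A).encard : ℝ≥0∞) ∂P)) :=
    tendsto_lintegral_of_dominated_convergence (fun ω => ((η ω ∩ A).encard : ℝ≥0∞))
      (fun n => hη.measurable_cellVoidCount U hA (hcell.measurable n))
      (fun n => ae_of_all _ fun ω => cellVoidCount_le U (hη.locallyFinite ω A hAb) (cell n))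
      (by rwa [hη.lintegral_count hA hμA])
      (ae_of_all _ fun ω => hcell.tendsto_cellVoidCount hU (hη.locallyFinite ω A hAb))
  refine tendsto_nhds_unique hleft ?_
  simp_rw [hη.lintegral_cellVoidCount hself hA hμA (hcell.measurable _)]
  refine tendsto_lintegral_of_dominated_convergence (fun _ => 1) (fun n => ?_)
    (fun n => ae_of_all _ fun x => prob_le_one) (by simpa using hμA) (ae_of_all _ fun x => ?_)
  · exact (Measurable.of_discrete (f := fun i =>
      poissonLaw (μ (innerInfluence U (cell n ⁻¹' {i}))) {0})).comp (hcell.measurable n)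
  · have hμU : μ (U x) ≠ ∞ := hη.measure_ne_top_of_isBounded (hbdd x)
    exact tendsto_poissonLaw_singleton_zero hμU (hcell.tendsto_measure_innerInfluence hU hμU)

end Mecke

end IsPoissonProcess

/-! ### The degree of the origin -/

section RadialShell

variable {X : Type*} [MetricSpace X]

/-- The points whose distance to `o` lies in `[k, k + 1)`. -/
def radialShell (o : X) (k : ℕ) : Set X := {x | ⌊dist o x⌋₊ = k}

theorem radialShell_subset_ball (o : X) (k : ℕ) : radialShell o k ⊆ Metric.ball o (k + 1) := by
  rintro x rfl
  exact Metric.mem_ball'.2 (Nat.lt_floor_add_one _)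

theorem isBounded_radialShell (o : X) (k : ℕ) : Bornology.IsBounded (radialShell o k) :=
  Metric.isBounded_ball.subset (radialShell_subset_ball o k)

theorem measurableSet_radialShell [MeasurableSpace X] [OpensMeasurableSpace X] (o : X) (k : ℕ) :
    MeasurableSet (radialShell o k) :=
  ((continuous_const.dist continuous_id).measurable.nat_floor) (measurableSet_singleton k)

theorem pairwise_disjoint_inter_radialShell (s : Set X) (o : X) :
    Pairwise (Function.onFun Disjoint fun k => s ∩ radialShell o k) := fun _ _ hij =>
  Set.disjoint_left.2 fun _ hi hj => hij (hi.2.symm.trans hj.2)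

theorem iUnion_inter_radialShell (s : Set X) (o : X) : ⋃ k, s ∩ radialShell o k = s := by
  ext x
  simp [radialShell]

theorem setLIntegral_eq_tsum_radialShell [MeasurableSpace X] [OpensMeasurableSpace X]
    {μ : Measure X} {A : Set X} (hA : MeasurableSet A) (o : X) (f : X → ℝ≥0∞) :
    ∫⁻ x in A, f x ∂μ = ∑' k, ∫⁻ x in A ∩ radialShell o k, f x ∂μ := by
  rw [← lintegral_iUnion (fun k => hA.inter (measurableSet_radialShell o k))
    (pairwise_disjoint_inter_radialShell A o), iUnion_inter_radialShell]

theorem setLIntegral_pow_floor_mul_eq_tsum [MeasurableSpace X] [OpensMeasurableSpace X]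
    {μ : Measure X} {A : Set X} (hA : MeasurableSet A) (o : X) {a : ℝ≥0∞} (ha : a ≠ ∞)
    (f : X → ℝ≥0∞) :
    ∫⁻ x in A, a ^ ⌊dist o x⌋₊ * f x ∂μ = ∑' k, a ^ k * ∫⁻ x in A ∩ radialShell o k, f x ∂μ := by
  rw [setLIntegral_eq_tsum_radialShell hA o]
  refine tsum_congr fun k => ?_
  rw [← lintegral_const_mul' _ _ (by finiteness)]
  refine setLIntegral_congr_fun (hA.inter (measurableSet_radialShell o k)) fun x hx => ?_
  rw [show ⌊dist o x⌋₊ = k from hx.2]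

theorem toENNReal_encard_iUnion {α : Type*} {s : ℕ → Set α}
    (hs : Pairwise (Function.onFun Disjoint s)) :
    ((⋃ i, s i).encard : ℝ≥0∞) = ∑' i, ((s i).encard : ℝ≥0∞) := by
  let _ : MeasurableSpace α := ⊤
  have hcount (t : Set α) : (t.encard : ℝ≥0∞) = Measure.count t :=
    (Measure.count_apply .of_discrete).symm
  simp_rw [hcount]
  exact measure_iUnion hs fun _ => .of_discrete

theorem encard_eq_tsum_radialShell (s : Set X) (o : X) :
    (s.encard : ℝ≥0∞) = ∑' k, ((s ∩ radialShell o k).encard : ℝ≥0∞) := by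
  rw [← toENNReal_encard_iUnion (pairwise_disjoint_inter_radialShell s o),
    iUnion_inter_radialShell]

theorem sum_encard_inter_radialShell_le {s ξ : Set X} (hs : s ⊆ ξ) (o : X) (k : ℕ) :
    ∑ j ∈ Finset.range (k + 1), ((s ∩ radialShell o j).encard : ℝ≥0∞) ≤
      (ξ ∩ Metric.ball o (k + 1)).encard := by
  rw [encard_eq_tsum_radialShell (ξ ∩ Metric.ball o (k + 1)) o]
  refine (Finset.sum_le_sum fun j hj => ?_).trans (ENNReal.sum_le_tsum (Finset.range (k + 1)))
  refine ENat.toENNReal_mono (Set.encard_le_encard fun x hx => ⟨⟨hs hx.1, ?_⟩, hx.2⟩)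
  have hjk : (j : ℝ) ≤ k := by exact_mod_cast Finset.mem_range_succ_iff.1 hj
  exact Metric.ball_subset_ball (by linarith) (radialShell_subset_ball o j hx.2)

end RadialShell

section RadialLens

variable {X : Type*} [MetricSpace X]

/-- The intersection of the balls around `o` and around `x` whose radius is the distance of
`o` and `x`. -/
def radialLens (o x : X) : Set X := Metric.ball o (dist o x) ∩ Metric.ball x (dist o x)

theorem mem_radialLens {o x z : X} :
    z ∈ radialLens o x ↔ dist o z < dist o x ∧ dist x z < dist o x := by
  rw [radialLens, Set.mem_inter_iff, Metric.mem_ball', Metric.mem_ball']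

theorem isBounded_radialLens (o x : X) : Bornology.IsBounded (radialLens o x) :=
  Metric.isBounded_ball.subset Set.inter_subset_left

theorem notMem_radialLens (o x : X) : x ∉ radialLens o x := fun h =>
  lt_irrefl _ (mem_radialLens.1 h).1

theorem isOpen_setOf_mem_radialLens (o : X) : IsOpen {p : X × X | p.2 ∈ radialLens o p.1} := by
  simp only [mem_radialLens]
  exact (isOpen_lt (f := fun p : X × X => dist o p.2) (g := fun p => dist o p.1)
    (by fun_prop) (by fun_prop)).inter (isOpen_lt (f := fun p : X × X => dist p.1 p.2)
    (g := fun p => dist o p.1) (by fun_prop) (by fun_prop))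

theorem isRadialNearestNeighbour_origin_iff {o x : X} {ξ : Set X} :
    IsRadialNearestNeighbour o ξ x o ↔ x ≠ o ∧ ξ ∩ radialLens o x = ∅ := by
  simp only [IsRadialNearestNeighbour, Set.mem_insert_iff, true_or, true_and, dist_self,
    dist_pos, Set.eq_empty_iff_forall_notMem, Set.mem_inter_iff, mem_radialLens, not_and, not_lt,
    forall_eq_or_imp, le_refl, implies_true]
  rw [ne_comm, dist_comm x o]

theorem originDegree_eq_encard_voidPoints (o : X) (ξ : Set X) :
    originDegree o ξ = (voidPoints (radialLens o) ξ ∩ {o}ᶜ).encard := by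
  rw [originDegree, ← Subtype.val_injective.encard_image]
  congr 1
  ext x
  simp only [Set.mem_image, SimpleGraph.mem_neighborSet, radialSpanningTree, Subtype.exists,
    exists_and_right, exists_eq_right, voidPoints, Set.mem_inter_iff, Set.mem_ofPred_eq,
    Set.mem_compl_singleton_iff, isRadialNearestNeighbour_origin_iff]
  constructor
  · rintro ⟨hx, h | h⟩
    · exact absurd h.2.1 (by simp)
    · exact ⟨⟨hx.resolve_left h.1, h.2⟩, h.1⟩
  · rintro ⟨⟨hx, h⟩, hxo⟩
    exact ⟨Or.inr hx, Or.inr ⟨hxo, h⟩⟩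

end RadialLens

section PowerBounds

theorem tsum_pow_le_tsum_pow_mul {s b : ℕ → ℝ≥0∞} (hs : ∀ k, s k = 0 ∨ 1 ≤ s k)
    (hb : ∀ k, ∑ j ∈ Finset.range (k + 1), s j ≤ b k) {n : ℕ} (hn : n ≠ 0) :
    (∑' k, s k) ^ n ≤ ∑' k, b k ^ n * s k := by
  have hpartial (m : ℕ) :
      (∑ k ∈ Finset.range m, s k) ^ n ≤ ∑ k ∈ Finset.range m, b k ^ n * s k := by
    induction m with
    | zero => simp [hn]
    | succ m ih =>
      rcases hs m with hzero | hone
      · simpa [Finset.sum_range_succ, hzero] using ih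
      · calc (∑ k ∈ Finset.range (m + 1), s k) ^ n ≤ b m ^ n := by gcongr; exact hb m
          _ ≤ b m ^ n * s m := le_mul_of_one_le_right' hone
          _ ≤ ∑ k ∈ Finset.range (m + 1), b k ^ n * s k :=
            Finset.single_le_sum (f := fun k => b k ^ n * s k) (fun _ _ => zero_le)
              (Finset.self_mem_range_succ m)
  exact le_of_tendsto (ENNReal.Tendsto.pow (ENNReal.tendsto_nat_tsum s))
    (.of_forall fun m => (hpartial m).trans (ENNReal.sum_le_tsum _))

theorem le_inv_mul_sq_add {t : ℝ≥0∞} (ht0 : t ≠ 0) (ht : t ≠ ∞) (c : ℝ≥0∞) :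
    c ≤ t⁻¹ * c ^ 2 + t := by
  rcases le_total c t with h | h
  · exact h.trans le_add_self
  · calc c = t⁻¹ * t * c := by rw [ENNReal.inv_mul_cancel ht0 ht, one_mul]
      _ ≤ t⁻¹ * c * c := by gcongr
      _ = t⁻¹ * c ^ 2 := by ring
      _ ≤ _ := le_self_add

theorem inv_pow_mul_geometric {C D q : ℝ≥0∞} (hq0 : q ≠ 0) (hq : q ≠ ∞) (p k : ℕ) :
    ((2 * q ^ p) ^ k)⁻¹ * (D * (C * q ^ k) ^ p) = D * C ^ p * 2⁻¹ ^ k := by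
  calc _ = D * C ^ p * 2⁻¹ ^ k * ((q ^ (p * k))⁻¹ * q ^ (p * k)) := by
        rw [mul_pow, mul_pow, ENNReal.mul_inv (by simp) (by simp), ENNReal.inv_pow (a := 2),
          ← pow_mul, ← pow_mul, mul_comm k]
        ring
    _ = _ := by rw [ENNReal.inv_mul_cancel (by simp [hq0]) (by finiteness), mul_one]

theorem encard_pow_le_tsum_radialShell {X : Type*} [MetricSpace X] {s ξ : Set X} (hs : s ⊆ ξ)
    (o : X) {n : ℕ} (hn : n ≠ 0) {a : ℝ≥0∞} (ha0 : a ≠ 0) (ha : a ≠ ∞) :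
    (s.encard : ℝ≥0∞) ^ n ≤
      ∑' k : ℕ, ((a ^ k)⁻¹ * ((ξ ∩ Metric.ball o (k + 1)).encard : ℝ≥0∞) ^ (2 * n + 1) +
        a ^ k * ((s ∩ radialShell o k).encard : ℝ≥0∞)) := by
  rw [encard_eq_tsum_radialShell s o]
  refine (tsum_pow_le_tsum_pow_mul (fun k => ?_)
    (fun k => sum_encard_inter_radialShell_le hs o k) hn).trans (ENNReal.tsum_le_tsum fun k => ?_)
  · rcases (s ∩ radialShell o k).eq_empty_or_nonempty with h | h
    · simp [h]
    · exact Or.inr (by exact_mod_cast Set.one_le_encard_iff_nonempty.2 h)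
  · set b : ℝ≥0∞ := ((ξ ∩ Metric.ball o (k + 1)).encard : ℝ≥0∞)
    set c : ℝ≥0∞ := ((s ∩ radialShell o k).encard : ℝ≥0∞)
    have hcb : c ≤ b := ENat.toENNReal_mono
      (Set.encard_le_encard (Set.inter_subset_inter hs (radialShell_subset_ball o k)))
    calc b ^ n * c ≤ ((a ^ k)⁻¹ * (b ^ n) ^ 2 + a ^ k) * c := by
          gcongr
          exact le_inv_mul_sq_add (by simp [ha0]) (by finiteness) _
      _ = (a ^ k)⁻¹ * (b ^ (2 * n) * c) + a ^ k * c := by ring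
      _ ≤ (a ^ k)⁻¹ * (b ^ (2 * n) * b) + a ^ k * c := by gcongr
      _ = _ := by rw [pow_succ]

end PowerBounds

namespace IsPoissonProcess

variable {Ω X : Type*} [MeasurableSpace Ω] [MetricSpace X] [MeasurableSpace X]
  [OpensMeasurableSpace X] [TopologicalSpace.SeparableSpace X]
  {η : Ω → Set X} {μ : Measure X} {P : Measure Ω}

section VoidPoints

variable {U : X → Set X}

theorem measurable_encard_voidPoints_inter (hη : IsPoissonProcess η μ P)
    (hU : IsOpen {p : X × X | p.2 ∈ U p.1}) {A : Set X} (hA : MeasurableSet A) :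
    Measurable fun ω => ((voidPoints U (η ω) ∩ A).encard : ℝ≥0∞) := by
  rcases isEmpty_or_nonempty X with hX | ⟨⟨o⟩⟩
  · simp [Set.eq_empty_of_isEmpty]
  simp_rw [encard_eq_tsum_radialShell (_ ∩ A) o, Set.inter_assoc]
  exact Measurable.tsum fun k => hη.measurable_encard_voidPoints_inter_of_isBounded hU
    (hA.inter (measurableSet_radialShell o k))
    ((isBounded_radialShell o k).subset Set.inter_subset_right)

theorem lintegral_encard_voidPoints_inter (hη : IsPoissonProcess η μ P)
    (hU : IsOpen {p : X × X | p.2 ∈ U p.1}) (hself : ∀ x, x ∉ U x)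
    (hbdd : ∀ x, Bornology.IsBounded (U x)) {A : Set X} (hA : MeasurableSet A) :
    ∫⁻ ω, ((voidPoints U (η ω) ∩ A).encard : ℝ≥0∞) ∂P =
      ∫⁻ x in A, poissonLaw (μ (U x)) {0} ∂μ := by
  rcases isEmpty_or_nonempty X with hX | ⟨⟨o⟩⟩
  · simp [Set.eq_empty_of_isEmpty]
  have hshell (k : ℕ) : MeasurableSet (A ∩ radialShell o k) :=
    hA.inter (measurableSet_radialShell o k)
  simp_rw [encard_eq_tsum_radialShell (_ ∩ A) o, Set.inter_assoc]
  rw [lintegral_tsum fun k => (hη.measurable_encard_voidPoints_inter hU (hshell k)).aemeasurable,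
    setLIntegral_eq_tsum_radialShell hA o]
  exact tsum_congr fun k => hη.lintegral_encard_voidPoints_inter_of_isBounded hU hself hbdd
    (hshell k) ((isBounded_radialShell o k).subset Set.inter_subset_right)

theorem lintegral_encard_voidPoints_inter_pow_le (hη : IsPoissonProcess η μ P)
    (hU : IsOpen {p : X × X | p.2 ∈ U p.1}) (hself : ∀ x, x ∉ U x)
    (hbdd : ∀ x, Bornology.IsBounded (U x)) {A : Set X} (hA : MeasurableSet A) (o : X) {n : ℕ}
    (hn : n ≠ 0) {a : ℝ≥0∞} (ha0 : a ≠ 0) (ha : a ≠ ∞) :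
    ∫⁻ ω, ((voidPoints U (η ω) ∩ A).encard : ℝ≥0∞) ^ n ∂P ≤
      ∑' k : ℕ, (a ^ k)⁻¹ *
          ∫⁻ ω, ((η ω ∩ Metric.ball o (k + 1)).encard : ℝ≥0∞) ^ (2 * n + 1) ∂P +
        ∫⁻ x in A, a ^ ⌊dist o x⌋₊ * poissonLaw (μ (U x)) {0} ∂μ := by
  have hshell (k : ℕ) : MeasurableSet (A ∩ radialShell o k) :=
    hA.inter (measurableSet_radialShell o k)
  have hball (k : ℕ) : Measurable fun ω =>
      ((η ω ∩ Metric.ball o ((k : ℝ) + 1)).encard : ℝ≥0∞) ^ (2 * n + 1) :=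
    (hη.measurable_toENNReal_count Metric.isOpen_ball.measurableSet).pow_const _
  have hvoid (k : ℕ) :
      Measurable fun ω => ((voidPoints U (η ω) ∩ (A ∩ radialShell o k)).encard : ℝ≥0∞) :=
    hη.measurable_encard_voidPoints_inter hU (hshell k)
  calc _ ≤ ∫⁻ ω, ∑' k : ℕ,
          ((a ^ k)⁻¹ * ((η ω ∩ Metric.ball o (k + 1)).encard : ℝ≥0∞) ^ (2 * n + 1) +
            a ^ k * ((voidPoints U (η ω) ∩ (A ∩ radialShell o k)).encard : ℝ≥0∞)) ∂P := by
        refine lintegral_mono fun ω => ?_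
        simp_rw [← Set.inter_assoc]
        exact encard_pow_le_tsum_radialShell
          (Set.inter_subset_left.trans (voidPoints_subset U (η ω))) o hn ha0 ha
    _ = _ := by
        rw [setLIntegral_pow_floor_mul_eq_tsum hA o ha, ← ENNReal.tsum_add,
          lintegral_tsum fun k => by fun_prop]
        refine tsum_congr fun k => ?_
        rw [lintegral_add_left ((hball k).const_mul _), lintegral_const_mul _ (hball k),
          lintegral_const_mul _ (hvoid k),
          hη.lintegral_encard_voidPoints_inter hU hself hbdd (hshell k)]

theorem lintegral_encard_voidPoints_inter_pow_lt_top (hη : IsPoissonProcess η μ P)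
    (hU : IsOpen {p : X × X | p.2 ∈ U p.1}) (hself : ∀ x, x ∉ U x)
    (hbdd : ∀ x, Bornology.IsBounded (U x)) {A : Set X} (hA : MeasurableSet A) (o : X)
    {C q : ℝ≥0∞} (hC : C ≠ ∞) (hq : q ≠ ∞)
    (hball : ∀ k : ℕ, μ (Metric.ball o (k + 1)) + 1 ≤ C * q ^ k)
    (hvoid : ∀ a : ℝ≥0∞, a ≠ ∞ →
      ∫⁻ x in A, a ^ ⌊dist o x⌋₊ * poissonLaw (μ (U x)) {0} ∂μ ≠ ∞) (n : ℕ) :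
    ∫⁻ ω, ((voidPoints U (η ω) ∩ A).encard : ℝ≥0∞) ^ n ∂P < ∞ := by
  have := hη.isProbabilityMeasure
  rcases eq_or_ne n 0 with rfl | hn
  · simp
  have hq0 : q ≠ 0 := by
    rintro rfl
    simpa using hball 1
  set p := 2 * n + 1
  obtain ⟨D, hD, hmoment⟩ := exists_lintegral_pow_poissonLaw_le p
  set a : ℝ≥0∞ := 2 * q ^ p with ha
  have ha0 : a ≠ 0 := by simp [ha, hq0]
  have hatop : a ≠ ∞ := by finiteness
  have hterm (k : ℕ) :
      (a ^ k)⁻¹ * ∫⁻ ω, ((η ω ∩ Metric.ball o (k + 1)).encard : ℝ≥0∞) ^ p ∂P ≤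
        D * C ^ p * 2⁻¹ ^ k := by
    rw [← inv_pow_mul_geometric hq0 hq,
      hη.lintegral_comp_count Metric.isOpen_ball.measurableSet fun x => (x : ℝ≥0∞) ^ p]
    gcongr
    refine (hmoment _ (hη.measure_ne_top_of_isBounded Metric.isBounded_ball)).trans ?_
    gcongr
    exact hball k
  refine (hη.lintegral_encard_voidPoints_inter_pow_le hU hself hbdd hA o hn ha0 hatop).trans_lt
    (ENNReal.add_lt_top.2 ⟨(ENNReal.tsum_le_tsum hterm).trans_lt ?_, (hvoid a hatop).lt_top⟩)
  rw [ENNReal.tsum_mul_left, ENNReal.tsum_geometric, ENNReal.one_sub_inv_two, inv_inv]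
  finiteness

end VoidPoints

theorem measurable_originDegree (hη : IsPoissonProcess η μ P) (o : X) :
    Measurable fun ω => originDegree o (η ω) := by
  refine measurable_to_countable' fun n => ?_
  have hpreimage : (fun ω => originDegree o (η ω)) ⁻¹' {n} =
      (fun ω => ((voidPoints (radialLens o) (η ω) ∩ {o}ᶜ).encard : ℝ≥0∞)) ⁻¹' {(n : ℝ≥0∞)} := by
    ext ω
    simp [originDegree_eq_encard_voidPoints]
  rw [hpreimage]
  exact hη.measurable_encard_voidPoints_inter (isOpen_setOf_mem_radialLens o)
    (measurableSet_singleton o).compl (measurableSet_singleton _)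

theorem lintegral_originDegree (hη : IsPoissonProcess η μ P) (o : X) :
    ∫⁻ ω, (originDegree o (η ω) : ℝ≥0∞) ∂P =
      ∫⁻ x in {o}ᶜ, poissonLaw (μ (radialLens o x)) {0} ∂μ := by
  simp_rw [originDegree_eq_encard_voidPoints]
  exact hη.lintegral_encard_voidPoints_inter (isOpen_setOf_mem_radialLens o) (notMem_radialLens o)
    (isBounded_radialLens o) (measurableSet_singleton o).compl

theorem lintegral_originDegree_pow_lt_top (hη : IsPoissonProcess η μ P) (o : X) {C q : ℝ≥0∞}
    (hC : C ≠ ∞) (hq : q ≠ ∞) (hball : ∀ k : ℕ, μ (Metric.ball o (k + 1)) + 1 ≤ C * q ^ k)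
    (hvoid : ∀ a : ℝ≥0∞, a ≠ ∞ →
      ∫⁻ x in {o}ᶜ, a ^ ⌊dist o x⌋₊ * poissonLaw (μ (radialLens o x)) {0} ∂μ ≠ ∞) (n : ℕ) :
    ∫⁻ ω, (originDegree o (η ω) : ℝ≥0∞) ^ n ∂P < ∞ := by
  simp_rw [originDegree_eq_encard_voidPoints]
  exact hη.lintegral_encard_voidPoints_inter_pow_lt_top (isOpen_setOf_mem_radialLens o)
    (notMem_radialLens o) (isBounded_radialLens o) (measurableSet_singleton o).compl o hC hq
    hball hvoid n

end IsPoissonProcess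

/-! ### Unboundedness of the degree of the origin -/

section Separation

variable {X : Type*} [MetricSpace X] {o : X}

theorem disjoint_radialLens_ball {p q x : X} {ε : ℝ} (hx : dist x p < ε)
    (hsep : dist o p + 3 * ε ≤ dist p q) : Disjoint (radialLens o x) (Metric.ball q ε) := by
  refine Set.disjoint_left.2 fun z hz hzq => ?_
  rw [Metric.mem_ball] at hzq
  linarith [(mem_radialLens.1 hz).2, dist_triangle4 p x z q, dist_triangle o p x,
    dist_comm p x]

theorem exists_pos_separation_margin {ι : Type*} [Finite ι] {p : ι → X}
    (hsep : ∀ i j, i ≠ j → dist o (p i) < dist (p i) (p j)) (hpo : ∀ i, p i ≠ o) :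
    ∃ ε > 0, (∀ i j, i ≠ j → dist o (p i) + 3 * ε ≤ dist (p i) (p j)) ∧
      ∀ i, ε ≤ dist o (p i) := by
  have hpair : ∀ᶠ ε in nhdsWithin (0 : ℝ) (Set.Ioi 0),
      ∀ i j, i ≠ j → dist o (p i) + 3 * ε ≤ dist (p i) (p j) := by
    simp only [Filter.eventually_all]
    intro i j hij
    have hlim : Filter.Tendsto (fun ε : ℝ => dist o (p i) + 3 * ε) (nhds 0)
        (nhds (dist o (p i) + 3 * 0)) := Continuous.tendsto (by fun_prop) 0
    exact ((hlim.eventually_lt_const (by simpa using hsep i j hij)).filter_mono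
      nhdsWithin_le_nhds).mono fun _ h => h.le
  have hradius : ∀ᶠ ε in nhdsWithin (0 : ℝ) (Set.Ioi 0), ∀ i, ε ≤ dist o (p i) :=
    Filter.eventually_all.2 fun i =>
      (eventually_le_nhds (dist_pos.2 (hpo i).symm)).filter_mono nhdsWithin_le_nhds
  obtain ⟨ε, ⟨hmargin, hle⟩, hε⟩ := ((hpair.and hradius).and self_mem_nhdsWithin).exists
  exact ⟨ε, hε, hmargin, hle⟩

variable {n : ℕ} {p : Fin n → X} {ε : ℝ}

theorem disjoint_ball_of_separated (hsep : ∀ i j, i ≠ j → dist o (p i) + 3 * ε ≤ dist (p i) (p j))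
    (hpo : ∀ i, ε ≤ dist o (p i)) :
    Pairwise (Function.onFun Disjoint fun i => Metric.ball (p i) ε) := fun i j hij =>
  Set.disjoint_left.2 fun x hi hj => by
    rw [Metric.mem_ball] at hi hj
    linarith [hsep i j hij, hpo i, dist_triangle_left (p i) (p j) x,
      dist_nonneg (x := x) (y := p i)]

/-- The union of the balls around `o` that reach just beyond the balls of radius `ε` around the
points `p i`, without these smaller balls. -/
def separatingRegion (o : X) (p : Fin n → X) (ε : ℝ) : Set X :=
  (⋃ i, Metric.ball o (dist o (p i) + ε)) \ ⋃ i, Metric.ball (p i) ε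

theorem isBounded_separatingRegion (o : X) (p : Fin n → X) (ε : ℝ) :
    Bornology.IsBounded (separatingRegion o p ε) :=
  (Bornology.isBounded_iUnion.2 fun _ => Metric.isBounded_ball).subset Set.sdiff_subset

theorem measurableSet_separatingRegion [MeasurableSpace X] [OpensMeasurableSpace X] (o : X)
    (p : Fin n → X) (ε : ℝ) : MeasurableSet (separatingRegion o p ε) :=
  (isOpen_iUnion fun _ => Metric.isOpen_ball).measurableSet.diff
    (isOpen_iUnion fun _ => Metric.isOpen_ball).measurableSet

theorem disjoint_separatingRegion_ball (o : X) (p : Fin n → X) (ε : ℝ) (i : Fin n) :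
    Disjoint (separatingRegion o p ε) (Metric.ball (p i) ε) :=
  Set.disjoint_sdiff_left.mono_right (Set.subset_iUnion (fun i => Metric.ball (p i) ε) i)

theorem inter_radialLens_eq_empty_of_separated
    (hsep : ∀ i j, i ≠ j → dist o (p i) + 3 * ε ≤ dist (p i) (p j)) {ξ : Set X}
    (hvoid : ξ ∩ separatingRegion o p ε = ∅) {i : Fin n} {x : X} (hx : x ∈ Metric.ball (p i) ε)
    (hmin : ∀ z ∈ ξ ∩ Metric.ball (p i) ε, dist o x ≤ dist o z) : ξ ∩ radialLens o x = ∅ := by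
  rw [Metric.mem_ball] at hx
  refine Set.eq_empty_of_forall_notMem fun z ⟨hzξ, hz⟩ => ?_
  have hzo : dist o z < dist o x := (mem_radialLens.1 hz).1
  have hzball : z ∈ ⋃ i, Metric.ball (p i) ε := by
    by_contra hzball
    refine hvoid.subset ⟨hzξ, Set.mem_iUnion.2 ⟨i, Metric.mem_ball'.2 ?_⟩, hzball⟩
    linarith [dist_triangle_right o x (p i)]
  obtain ⟨j, hj⟩ := Set.mem_iUnion.1 hzball
  rcases eq_or_ne i j with rfl | hij
  · exact hzo.not_ge (hmin z ⟨hzξ, hj⟩)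
  · exact Set.disjoint_left.1 (disjoint_radialLens_ball hx (hsep i j hij)) hz hj

-- In each ball around a `p i`, the point of `ξ` closest to `o` is joined to `o`.
theorem natCast_le_originDegree
    (hsep : ∀ i j, i ≠ j → dist o (p i) + 3 * ε ≤ dist (p i) (p j))
    (hpo : ∀ i, ε ≤ dist o (p i)) {ξ : Set X} (hfin : ∀ i, (ξ ∩ Metric.ball (p i) ε).Finite)
    (hne : ∀ i, (ξ ∩ Metric.ball (p i) ε).Nonempty) (hvoid : ξ ∩ separatingRegion o p ε = ∅) :
    (n : ℕ∞) ≤ originDegree o ξ := by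
  choose x hx hmin using fun i => Set.exists_min_image _ (dist o) (hfin i) (hne i)
  have hinj : Function.Injective x := fun i j hij => by_contra fun hne =>
    Set.disjoint_left.1 (disjoint_ball_of_separated hsep hpo hne) (hx i).2 (hij ▸ (hx j).2)
  have hsub : Set.range x ⊆ voidPoints (radialLens o) ξ ∩ {o}ᶜ := by
    rintro _ ⟨i, rfl⟩
    refine ⟨⟨(hx i).1, inter_radialLens_eq_empty_of_separated hsep hvoid (hx i).2 (hmin i)⟩,
      fun hxo => ?_⟩
    exact (Set.mem_singleton_iff.1 hxo ▸ (hx i).2 : o ∈ Metric.ball (p i) ε).not_ge (hpo i)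
  calc (n : ℕ∞) ≤ (Set.range x).encard := by simpa using hinj.encard_range
    _ ≤ originDegree o ξ := by
      rw [originDegree_eq_encard_voidPoints]
      exact Set.encard_le_encard hsub

end Separation

namespace IsPoissonProcess

variable {Ω X : Type*} [MeasurableSpace Ω] [MetricSpace X] [MeasurableSpace X]
  {η : Ω → Set X} {μ : Measure X} {P : Measure Ω}

theorem measure_forall_count_mem_pos (hη : IsPoissonProcess η μ P) {k : ℕ} {B : Fin k → Set X}
    (hB : ∀ i, MeasurableSet (B i)) (hdisj : Pairwise (Function.onFun Disjoint B))
    {S : Fin k → Set ℕ∞} (hS : ∀ i, 0 < poissonLaw (μ (B i)) (S i)) :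
    0 < P {ω | ∀ i, (η ω ∩ B i).encard ∈ S i} := by
  have hprod := (iIndepFun_iff_measure_inter_preimage_eq_mul.1 (hη.indep_count k B hB hdisj))
    Finset.univ (sets := S) fun i _ => .of_discrete
  have hinter : ⋂ i ∈ Finset.univ, (fun ω => (η ω ∩ B i).encard) ⁻¹' S i =
      {ω | ∀ i, (η ω ∩ B i).encard ∈ S i} := by
    ext ω
    simp
  rw [← hinter, hprod, pos_iff_ne_zero, Finset.prod_ne_zero_iff]
  intro i _
  rw [← Measure.map_apply (hη.measurable_count _ (hB i)) .of_discrete, hη.law_count _ (hB i)]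
  exact (hS i).ne'

theorem measure_void_and_nonempty_pos (hη : IsPoissonProcess η μ P) {V : Set X}
    (hV : MeasurableSet V) (hμV : μ V ≠ ∞) {n : ℕ} {B : Fin n → Set X}
    (hB : ∀ i, MeasurableSet (B i)) (hμB : ∀ i, μ (B i) ≠ 0)
    (hdisj : Pairwise (Function.onFun Disjoint B)) (hVB : ∀ i, Disjoint V (B i)) :
    0 < P {ω | η ω ∩ V = ∅ ∧ ∀ i, (η ω ∩ B i).Nonempty} := by
  have hpos := hη.measure_forall_count_mem_pos (B := Fin.cons V B)
    (S := Fin.cons {0} fun _ => {0}ᶜ) (Fin.cases hV hB)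
    (fun i j => Fin.cases
      (Fin.cases (fun h => absurd rfl h) (fun j _ => hVB j) j)
      (fun i => Fin.cases (fun _ => (hVB i).symm)
        (fun j h => hdisj fun hij => h (congrArg Fin.succ hij)) j) i)
    (Fin.cases (poissonLaw_singleton_zero_pos hμV)
      fun i => poissonLaw_singleton_zero_compl_pos (hμB i))
  simpa [Fin.forall_fin_succ, Set.nonempty_iff_ne_empty] using hpos

theorem measure_le_originDegree_pos [OpensMeasurableSpace X] (hη : IsPoissonProcess η μ P)
    (hpos : ∀ x r, 0 < r → μ (Metric.ball x r) ≠ 0) {o : X} {n : ℕ} {p : Fin n → X}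
    (hsep : ∀ i j, i ≠ j → dist o (p i) < dist (p i) (p j)) (hpo : ∀ i, p i ≠ o) :
    0 < P {ω | (n : ℕ∞) ≤ originDegree o (η ω)} := by
  obtain ⟨ε, hε, hmargin, hradius⟩ := exists_pos_separation_margin hsep hpo
  refine (hη.measure_void_and_nonempty_pos (measurableSet_separatingRegion o p ε)
    (hη.measure_ne_top_of_isBounded (isBounded_separatingRegion o p ε))
    (fun i => Metric.isOpen_ball.measurableSet) (fun i => hpos (p i) ε hε)
    (disjoint_ball_of_separated hmargin hradius)
    (disjoint_separatingRegion_ball o p ε)).trans_le (measure_mono fun ω hω => ?_)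
  exact natCast_le_originDegree hmargin hradius
    (fun i => hη.locallyFinite ω _ Metric.isBounded_ball) hω.2 hω.1

end IsPoissonProcess

/-! ### Comparison of measures -/

theorem measure_le_of_locally_le {X : Type*} [TopologicalSpace X] [SecondCountableTopology X]
    [MeasurableSpace X] [OpensMeasurableSpace X] {μ ν : Measure X}
    (h : ∀ x, ∃ U : Set X, IsOpen U ∧ x ∈ U ∧ ∀ A ⊆ U, MeasurableSet A → μ A ≤ ν A) : μ ≤ ν := by
  choose U hUo hxU hU using h
  obtain ⟨s, hs, hcov⟩ := TopologicalSpace.countable_cover_nhds fun x => (hUo x).mem_nhds (hxU x)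
  rcases s.eq_empty_or_nonempty with rfl | hne
  · have : IsEmpty X := Set.univ_eq_empty_iff.1 (hcov.symm.trans (Set.biUnion_empty _))
    exact (Measure.eq_zero_of_isEmpty μ).trans_le (Measure.zero_le ν)
  obtain ⟨f, rfl⟩ := hs.exists_eq_range hne
  rw [Set.biUnion_range] at hcov
  refine Measure.le_iff.2 fun A hA => ?_
  set V := disjointed fun n => U (f n) with hV
  have hVm : ∀ n, MeasurableSet (A ∩ V n) := fun n =>
    hA.inter (MeasurableSet.disjointed (fun n => (hUo (f n)).measurableSet) n)
  have hVd : Pairwise (Function.onFun Disjoint fun n => A ∩ V n) := fun i j hij =>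
    (disjoint_disjointed _ hij).mono Set.inter_subset_right Set.inter_subset_right
  have hAV : A = ⋃ n, A ∩ V n := by
    rw [← Set.inter_iUnion, hV, iUnion_disjointed, hcov, Set.inter_univ]
  rw [hAV, measure_iUnion hVd hVm, measure_iUnion hVd hVm]
  exact ENNReal.tsum_le_tsum fun n => hU (f n) _
    (Set.inter_subset_right.trans (disjointed_subset _ n)) (hVm n)

theorem measure_le_of_tendsto_smul {X ι : Type*} [MeasurableSpace X] {μ ν : Measure X}
    {l : Filter ι} [l.NeBot] {c : ι → ℝ≥0∞} (hc : Filter.Tendsto c l (nhds 1))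
    (h : ∀ᶠ i in l, μ ≤ c i • ν) : μ ≤ ν := by
  refine Measure.le_iff.2 fun A _ => ?_
  have hlim : Filter.Tendsto (fun i => c i * ν A) l (nhds (ν A)) := by
    simpa only [one_mul] using ENNReal.Tendsto.mul_const hc (Or.inl one_ne_zero)
  exact ge_of_tendsto hlim (h.mono fun i hi => hi A)

section HausdorffMeasure

variable {X Y : Type*} [MetricSpace X] [MeasurableSpace X] [BorelSpace X] [MetricSpace Y]
  [MeasurableSpace Y] [BorelSpace Y] {K : ℝ≥0} {f : X → Y} {s : Set X}

theorem euclideanHausdorffMeasure_image_le (h : LipschitzOnWith K f s) (d : ℕ) :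
    (Measure.euclideanHausdorffMeasure d : Measure Y) (f '' s) ≤
      (K : ℝ≥0∞) ^ d * (Measure.euclideanHausdorffMeasure d : Measure X) s := by
  rw [Measure.euclideanHausdorffMeasure_def, Measure.euclideanHausdorffMeasure_def,
    Measure.smul_apply, Measure.smul_apply, ENNReal.smul_def, ENNReal.smul_def, smul_eq_mul,
    smul_eq_mul, mul_left_comm]
  gcongr
  simpa using h.hausdorffMeasure_image_le (d := d) (by positivity)

theorem euclideanHausdorffMeasure_le_image
    (h : ∀ x ∈ s, ∀ y ∈ s, dist x y ≤ K * dist (f x) (f y)) (d : ℕ) :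
    (Measure.euclideanHausdorffMeasure d : Measure X) s ≤
      (K : ℝ≥0∞) ^ d * (Measure.euclideanHausdorffMeasure d : Measure Y) (f '' s) := by
  rcases s.eq_empty_or_nonempty with rfl | ⟨x₀, -⟩
  · simp
  have : Nonempty X := ⟨x₀⟩
  have hinj : Set.InjOn f s := fun x hx y hy hxy =>
    dist_le_zero.1 ((h x hx y hy).trans_eq (by rw [hxy, dist_self, mul_zero]))
  have hinv := hinj.leftInvOn_invFunOn
  have hlip : LipschitzOnWith K (Function.invFunOn f s) (f '' s) := by
    refine LipschitzOnWith.of_dist_le_mul ?_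
    rintro _ ⟨x, hx, rfl⟩ _ ⟨y, hy, rfl⟩
    rw [hinv hx, hinv hy]
    exact h x hx y hy
  simpa only [hinv.image_image] using euclideanHausdorffMeasure_image_le hlip d

end HausdorffMeasure

/-! ### The hyperbolic volume in the half-space model -/

theorem sinh_le_mul_cosh {x : ℝ} (hx : 0 ≤ x) : Real.sinh x ≤ x * Real.cosh x := by
  have hmvt := (convex_Icc 0 x).image_sub_le_mul_sub_of_deriv_le (f := Real.sinh)
    (C := Real.cosh x) Real.continuous_sinh.continuousOn Real.differentiable_sinh.differentiableOn
    (fun y hy => by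
      rw [interior_Icc] at hy
      rw [Real.deriv_sinh, Real.cosh_le_cosh, abs_of_pos hy.1, abs_of_nonneg hx]
      exact hy.2.le)
    0 (Set.left_mem_Icc.2 hx) x (Set.right_mem_Icc.2 hx) hx
  simpa [mul_comm] using hmvt

namespace HyperbolicSpace

variable {d : ℕ} [NeZero d] {ϰ : ℝ}

theorem cosh_unitDist (x y : HyperbolicSpace d ϰ) :
    Real.cosh (unitDist x y) = 1 + ‖x.point - y.point‖ ^ 2 / (2 * x.height * y.height) :=
  Real.cosh_arcosh (one_le_arg x y)

theorem abs_height_sub_height_le (x y : HyperbolicSpace d ϰ) :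
    |x.height - y.height| ≤ ‖x.point - y.point‖ :=
  PiLp.norm_apply_le (x.point - y.point) ⟨d - 1, Nat.sub_one_lt (NeZero.ne d)⟩

theorem unitDist_le (x y : HyperbolicSpace d ϰ) :
    unitDist x y ≤ ‖x.point - y.point‖ / √(x.height * y.height) := by
  have hhalf : unitDist x y / 2 ≤ ‖x.point - y.point‖ / (2 * √(x.height * y.height)) :=
    (Real.self_le_sinh_iff.2 (by linarith [unitDist_nonneg x y])).trans_eq
      (sinh_half_unitDist x y)
  rw [mul_comm, ← div_div] at hhalf
  linarith

theorem height_le_exp_mul (x y : HyperbolicSpace d ϰ) :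
    x.height ≤ Real.exp (unitDist x y) * y.height := by
  have hx := x.height_pos
  have hy := y.height_pos
  by_contra! hlt
  have hlog : unitDist x y < Real.log (x.height / y.height) := by
    rwa [Real.lt_log_iff_exp_lt (by positivity), lt_div_iff₀ hy]
  have hcosh : Real.cosh (unitDist x y) < Real.cosh (Real.log (x.height / y.height)) := by
    rw [Real.cosh_lt_cosh, abs_of_nonneg (unitDist_nonneg x y)]
    exact hlog.trans_le (le_abs_self _)
  have hheight : Real.cosh (Real.log (x.height / y.height)) =
      1 + (x.height - y.height) ^ 2 / (2 * x.height * y.height) := by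
    rw [Real.cosh_log (by positivity)]
    field_simp
    ring
  rw [cosh_unitDist, hheight] at hcosh
  refine absurd hcosh (not_lt.2 ?_)
  gcongr 1 + ?_ / _
  exact sq_le_sq.2 ((abs_height_sub_height_le x y).trans (le_abs_self _))

theorem norm_point_sub_point_sq_le (x y : HyperbolicSpace d ϰ) :
    ‖x.point - y.point‖ ^ 2 ≤
      2 * y.height ^ 2 * Real.exp (unitDist x y) * (Real.cosh (unitDist x y) - 1) := by
  have hx := x.height_pos
  have hy := y.height_pos
  have hcosh : 0 ≤ Real.cosh (unitDist x y) - 1 := sub_nonneg.2 (Real.one_le_cosh _)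
  calc ‖x.point - y.point‖ ^ 2
      = 2 * x.height * y.height * (Real.cosh (unitDist x y) - 1) := by
        rw [cosh_unitDist]
        field_simp
        ring
    _ ≤ 2 * (Real.exp (unitDist x y) * y.height) * y.height *
        (Real.cosh (unitDist x y) - 1) := by
        gcongr
        exact height_le_exp_mul x y
    _ = _ := by ring

theorem point_injective :
    Function.Injective (point : HyperbolicSpace d ϰ → EuclideanSpace ℝ (Fin d)) :=
  fun _ _ h => HyperbolicSpace.ext h

/-- The coordinate of `ℝ^d` that measures the height in the half-space model, as a linear form. -/
noncomputable def heightForm (d : ℕ) [NeZero d] : EuclideanSpace ℝ (Fin d) →L[ℝ] ℝ :=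
  EuclideanSpace.proj ⟨d - 1, Nat.sub_one_lt (NeZero.ne d)⟩

@[simp]
theorem heightForm_point (x : HyperbolicSpace d ϰ) : heightForm d x.point = x.height := rfl

theorem range_point : Set.range (point : HyperbolicSpace d ϰ → EuclideanSpace ℝ (Fin d)) =
    {x | 0 < heightForm d x} :=
  Set.Subset.antisymm (by rintro _ ⟨x, rfl⟩; exact x.height_pos) fun x hx => ⟨⟨x, hx⟩, rfl⟩

section Topology

variable [Fact (0 < ϰ)]

theorem unitDist_eq_sqrt_mul_dist (x y : HyperbolicSpace d ϰ) : unitDist x y = √ϰ * dist x y := by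
  have hϰ : 0 < ϰ := Fact.out
  rw [dist_def]
  field_simp

theorem continuous_point : Continuous (point : HyperbolicSpace d ϰ → EuclideanSpace ℝ (Fin d)) := by
  rw [continuous_iff_continuousAt]
  intro y
  rw [ContinuousAt, tendsto_iff_norm_sub_tendsto_zero]
  have hbound : Continuous fun x => √(2 * y.height ^ 2 * Real.exp (√ϰ * dist x y) *
      (Real.cosh (√ϰ * dist x y) - 1)) := by fun_prop
  refine squeeze_zero (fun _ => norm_nonneg _) (fun x => ?_)
    (by simpa only [dist_self, mul_zero, Real.cosh_zero, sub_self, Real.sqrt_zero]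
      using hbound.tendsto y)
  rw [← unitDist_eq_sqrt_mul_dist]
  exact Real.le_sqrt_of_sq_le (norm_point_sub_point_sq_le x y)

theorem comap_point_nhds_le (y : HyperbolicSpace d ϰ) :
    Filter.comap (point : HyperbolicSpace d ϰ → _) (nhds y.point) ≤ nhds y := by
  have hy := y.height_pos
  rw [← Filter.tendsto_id', tendsto_iff_dist_tendsto_zero]
  set l := Filter.comap (point : HyperbolicSpace d ϰ → _) (nhds y.point)
  have hpoint : Filter.Tendsto (point : HyperbolicSpace d ϰ → _) l (nhds y.point) :=
    Filter.tendsto_comap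
  have hheight : Filter.Tendsto (height : HyperbolicSpace d ϰ → _) l (nhds y.height) :=
    ((heightForm d).continuous.tendsto y.point).comp hpoint
  have hbound : Filter.Tendsto
      (fun x => 1 / √ϰ * (‖x.point - y.point‖ / √(x.height * y.height))) l (nhds 0) := by
    have hlim := (((hpoint.sub_const y.point).norm).div ((hheight.mul_const y.height).sqrt)
      (by positivity)).const_mul (1 / √ϰ)
    simpa only [sub_self, norm_zero, zero_div, mul_zero, Pi.div_apply] using hlim
  refine squeeze_zero (fun _ => dist_nonneg) (fun x => ?_) hbound
  rw [id, dist_def]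
  gcongr
  exact unitDist_le x y

theorem isOpenEmbedding_point :
    Topology.IsOpenEmbedding (point : HyperbolicSpace d ϰ → EuclideanSpace ℝ (Fin d)) := by
  refine ⟨⟨Topology.isInducing_iff_nhds.2 fun y => ?_, point_injective⟩, ?_⟩
  · exact le_antisymm (continuous_point.tendsto y).le_comap (comap_point_nhds_le y)
  · rw [range_point]
    exact isOpen_lt continuous_const (heightForm d).continuous

instance : SecondCountableTopology (HyperbolicSpace d ϰ) :=
  isOpenEmbedding_point.isInducing.secondCountableTopology

theorem measurableEmbedding_point :
    MeasurableEmbedding (point : HyperbolicSpace d ϰ → EuclideanSpace ℝ (Fin d)) :=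
  isOpenEmbedding_point.measurableEmbedding

end Topology

/-- The set of points whose Euclidean distance to `p` is less than `ε` times the height of `p`; on
it the hyperbolic metric is nearly a multiple of the Euclidean one. -/
def relBall (p : HyperbolicSpace d ϰ) (ε : ℝ) : Set (HyperbolicSpace d ϰ) :=
  {x | ‖x.point - p.point‖ < ε * p.height}

section RelBall

variable {p x y : HyperbolicSpace d ϰ} {ε : ℝ}

theorem mem_relBall : x ∈ relBall p ε ↔ ‖x.point - p.point‖ < ε * p.height := Iff.rfl

theorem mem_relBall_self (p : HyperbolicSpace d ϰ) (hε : 0 < ε) : p ∈ relBall p ε := by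
  simpa [mem_relBall] using mul_pos hε p.height_pos

theorem isOpen_relBall [Fact (0 < ϰ)] (p : HyperbolicSpace d ϰ) (ε : ℝ) : IsOpen (relBall p ε) :=
  isOpen_lt (continuous_point.sub continuous_const).norm continuous_const

theorem height_mem_Icc_of_mem_relBall (hx : x ∈ relBall p ε) :
    x.height ∈ Set.Icc ((1 - ε) * p.height) ((1 + ε) * p.height) := by
  have h := abs_le.1 ((abs_height_sub_height_le x p).trans (mem_relBall.1 hx).le)
  constructor <;> linarith [h.1, h.2]

theorem sqrt_height_mul_height_mem_Icc (hε : ε ≤ 1) (hx : x ∈ relBall p ε)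
    (hy : y ∈ relBall p ε) :
    √(x.height * y.height) ∈ Set.Icc ((1 - ε) * p.height) ((1 + ε) * p.height) := by
  have hxh := height_mem_Icc_of_mem_relBall hx
  have hyh := height_mem_Icc_of_mem_relBall hy
  have hlower : 0 ≤ (1 - ε) * p.height := mul_nonneg (by linarith) p.height_pos.le
  have hupper : 0 ≤ (1 + ε) * p.height := x.height_pos.le.trans hxh.2
  refine ⟨Real.le_sqrt_of_sq_le ?_, Real.sqrt_le_iff.2 ⟨hupper, ?_⟩⟩
  · rw [sq]
    exact mul_le_mul hxh.1 hyh.1 hlower x.height_pos.le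
  · rw [sq]
    exact mul_le_mul hxh.2 hyh.2 y.height_pos.le hupper

theorem norm_sub_lt_of_mem_relBall (hx : x ∈ relBall p ε) (hy : y ∈ relBall p ε) :
    ‖x.point - y.point‖ < 2 * ε * p.height := by
  have h := norm_sub_le_norm_sub_add_norm_sub x.point p.point y.point
  rw [norm_sub_rev p.point] at h
  linarith [mem_relBall.1 hx, mem_relBall.1 hy]

theorem cosh_half_unitDist_le_of_mem_relBall (hε0 : 0 < ε) (hε : ε ≤ 1 / 4)
    (hx : x ∈ relBall p ε) (hy : y ∈ relBall p ε) :
    Real.cosh (unitDist x y / 2) ≤ 1 + ε := by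
  have hp := p.height_pos
  have hS := (sqrt_height_mul_height_mem_Icc (by linarith) hx hy).1
  have hsinh_nonneg : 0 ≤ Real.sinh (unitDist x y / 2) :=
    Real.sinh_nonneg_iff.2 (by linarith [unitDist_nonneg x y])
  have hsinh : Real.sinh (unitDist x y / 2) ≤ 4 / 3 * ε := by
    have hheight : 3 / 4 * p.height ≤ √(x.height * y.height) :=
      le_trans (by gcongr; linarith) hS
    have hS0 : 0 < √(x.height * y.height) := lt_of_lt_of_le (by positivity) hheight
    rw [sinh_half_unitDist, div_le_iff₀ (by positivity)]
    nlinarith [norm_sub_lt_of_mem_relBall hx hy]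
  refine (abs_le_of_sq_le_sq' ?_ (by positivity)).2
  rw [Real.cosh_sq]
  nlinarith

variable [Fact (0 < ϰ)]

theorem dist_le_of_mem_relBall (hε : ε < 1) (hx : x ∈ relBall p ε) (hy : y ∈ relBall p ε) :
    dist x y ≤ ((1 - ε) * (√ϰ * p.height))⁻¹ * dist x.point y.point := by
  have hϰ : 0 < ϰ := Fact.out
  have hlower : 0 < (1 - ε) * p.height := mul_pos (by linarith) p.height_pos
  have hS := (sqrt_height_mul_height_mem_Icc hε.le hx hy).1
  calc dist x y = 1 / √ϰ * unitDist x y := dist_def x y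
    _ ≤ 1 / √ϰ * (‖x.point - y.point‖ / √(x.height * y.height)) := by
        gcongr
        exact unitDist_le x y
    _ ≤ 1 / √ϰ * (‖x.point - y.point‖ / ((1 - ε) * p.height)) := by gcongr
    _ = _ := by
        rw [dist_eq_norm, mul_left_comm, mul_inv, one_div, div_eq_inv_mul, mul_assoc]

theorem dist_point_le_of_mem_relBall (hε0 : 0 < ε) (hε : ε ≤ 1 / 4) (hx : x ∈ relBall p ε)
    (hy : y ∈ relBall p ε) :
    dist x.point y.point ≤ (1 + ε) ^ 2 * (√ϰ * p.height) * dist x y := by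
  have hp := p.height_pos
  have hS := (sqrt_height_mul_height_mem_Icc (by linarith) hx hy).2
  have hS0 : 0 < √(x.height * y.height) :=
    Real.sqrt_pos.2 (mul_pos x.height_pos y.height_pos)
  have hdist : 0 ≤ unitDist x y / 2 := by linarith [unitDist_nonneg x y]
  have hsinh : Real.sinh (unitDist x y / 2) ≤ unitDist x y / 2 * (1 + ε) :=
    (sinh_le_mul_cosh hdist).trans
      (mul_le_mul_of_nonneg_left (cosh_half_unitDist_le_of_mem_relBall hε0 hε hx hy) hdist)
  calc dist x.point y.point
      = 2 * √(x.height * y.height) * Real.sinh (unitDist x y / 2) := by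
        rw [sinh_half_unitDist, dist_eq_norm]
        field_simp
    _ ≤ 2 * ((1 + ε) * p.height) * (unitDist x y / 2 * (1 + ε)) := by gcongr
    _ = _ := by
        rw [unitDist_eq_sqrt_mul_dist]
        ring

end RelBall

/-- The density `(√ϰ x_d)⁻ᵈ` of the Riemannian volume of the half-space model with respect to
Lebesgue measure. -/
noncomputable def volumeDensity (ϰ : ℝ) (d : ℕ) [NeZero d] (x : EuclideanSpace ℝ (Fin d)) : ℝ≥0∞ :=
  ENNReal.ofReal ((√ϰ * heightForm d x)⁻¹ ^ d)

theorem measurable_volumeDensity : Measurable (volumeDensity ϰ d) := by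
  unfold volumeDensity
  fun_prop

variable [Fact (0 < ϰ)] {p : HyperbolicSpace d ϰ} {ε : ℝ} {A : Set (HyperbolicSpace d ϰ)}

/-- The Riemannian volume of the half-space model, given by its density. It is shown to agree with
`hyperbolicVolume`, which is the Hausdorff measure of the metric. -/
noncomputable def densityVolume (d : ℕ) [NeZero d] (ϰ : ℝ) [Fact (0 < ϰ)] :
    Measure (HyperbolicSpace d ϰ) :=
  Measure.comap point (volume.withDensity (volumeDensity ϰ d))

theorem densityVolume_apply (hA : MeasurableSet A) :
    densityVolume d ϰ A = ∫⁻ x in point '' A, volumeDensity ϰ d x := by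
  rw [densityVolume, measurableEmbedding_point.comap_apply,
    withDensity_apply _ (measurableEmbedding_point.measurableSet_image.2 hA)]

theorem mul_volume_image_point_le_densityVolume (hε0 : 0 < ε) (hA : A ⊆ relBall p ε)
    (hAm : MeasurableSet A) :
    ENNReal.ofReal ((√ϰ * ((1 + ε) * p.height))⁻¹ ^ d) * volume (point '' A) ≤
      densityVolume d ϰ A := by
  have hϰ : 0 < ϰ := Fact.out
  have hp := p.height_pos
  rw [densityVolume_apply hAm, ← setLIntegral_const]
  refine setLIntegral_mono' (measurableEmbedding_point.measurableSet_image.2 hAm) ?_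
  rintro _ ⟨x, hx, rfl⟩
  have hxpos := x.height_pos
  rw [volumeDensity, heightForm_point]
  gcongr
  exact (height_mem_Icc_of_mem_relBall (hA hx)).2

theorem densityVolume_le_mul_volume_image_point (hε : ε < 1) (hA : A ⊆ relBall p ε)
    (hAm : MeasurableSet A) :
    densityVolume d ϰ A ≤
      ENNReal.ofReal ((√ϰ * ((1 - ε) * p.height))⁻¹ ^ d) * volume (point '' A) := by
  have hϰ : 0 < ϰ := Fact.out
  have hlower : 0 < (1 - ε) * p.height := mul_pos (by linarith) p.height_pos
  rw [densityVolume_apply hAm, ← setLIntegral_const]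
  refine setLIntegral_mono' (measurableEmbedding_point.measurableSet_image.2 hAm) ?_
  rintro _ ⟨x, hx, rfl⟩
  have hxpos := x.height_pos
  rw [volumeDensity, heightForm_point]
  gcongr
  exact (height_mem_Icc_of_mem_relBall (hA hx)).1

theorem hyperbolicVolume_le_of_subset_relBall (hε0 : 0 < ε) (hε : ε < 1)
    (hA : A ⊆ relBall p ε) (hAm : MeasurableSet A) :
    hyperbolicVolume d ϰ A ≤
      ENNReal.ofReal (((1 + ε) / (1 - ε)) ^ d) * densityVolume d ϰ A := by
  have hϰ : 0 < ϰ := Fact.out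
  have hp := p.height_pos
  have hε_lt : 0 < 1 - ε := by linarith
  have hK : 0 ≤ ((1 - ε) * (√ϰ * p.height))⁻¹ := by positivity
  have hhausdorff := euclideanHausdorffMeasure_le_image (f := point) (s := A)
    (K := ((1 - ε) * (√ϰ * p.height))⁻¹.toNNReal)
    (fun x hx y hy => by
      rw [Real.coe_toNNReal _ hK]
      exact dist_le_of_mem_relBall hε (hA hx) (hA hy)) d
  rw [EuclideanSpace.euclideanHausdorffMeasure_eq_volume, ← ENNReal.ofReal,
    ← ENNReal.ofReal_pow hK] at hhausdorff
  calc hyperbolicVolume d ϰ A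
      ≤ ENNReal.ofReal (((1 - ε) * (√ϰ * p.height))⁻¹ ^ d) * volume (point '' A) := hhausdorff
    _ = ENNReal.ofReal (((1 + ε) / (1 - ε)) ^ d) *
        (ENNReal.ofReal ((√ϰ * ((1 + ε) * p.height))⁻¹ ^ d) * volume (point '' A)) := by
        rw [← mul_assoc (ENNReal.ofReal _), ← ENNReal.ofReal_mul (by positivity), ← mul_pow]
        congr 3
        field_simp
    _ ≤ _ := by
        gcongr
        exact mul_volume_image_point_le_densityVolume hε0 hA hAm

theorem densityVolume_le_of_subset_relBall (hε0 : 0 < ε) (hε : ε ≤ 1 / 4) (hA : A ⊆ relBall p ε)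
    (hAm : MeasurableSet A) :
    densityVolume d ϰ A ≤
      ENNReal.ofReal (((1 + ε) ^ 2 / (1 - ε)) ^ d) * hyperbolicVolume d ϰ A := by
  have hϰ : 0 < ϰ := Fact.out
  have hp := p.height_pos
  have hε_lt : 0 < 1 - ε := by linarith
  have hK : 0 ≤ (1 + ε) ^ 2 * (√ϰ * p.height) := by positivity
  have hlip : LipschitzOnWith ((1 + ε) ^ 2 * (√ϰ * p.height)).toNNReal point A :=
    LipschitzOnWith.of_dist_le_mul fun x hx y hy => by
      rw [Real.coe_toNNReal _ hK]
      exact dist_point_le_of_mem_relBall hε0 hε (hA hx) (hA hy)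
  have hhausdorff := euclideanHausdorffMeasure_image_le hlip d
  rw [EuclideanSpace.euclideanHausdorffMeasure_eq_volume, ← ENNReal.ofReal,
    ← ENNReal.ofReal_pow hK] at hhausdorff
  calc densityVolume d ϰ A
      ≤ ENNReal.ofReal ((√ϰ * ((1 - ε) * p.height))⁻¹ ^ d) * volume (point '' A) :=
        densityVolume_le_mul_volume_image_point (by linarith) hA hAm
    _ ≤ ENNReal.ofReal ((√ϰ * ((1 - ε) * p.height))⁻¹ ^ d) *
        (ENNReal.ofReal (((1 + ε) ^ 2 * (√ϰ * p.height)) ^ d) * hyperbolicVolume d ϰ A) := by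
        gcongr
        exact hhausdorff
    _ = _ := by
        rw [← mul_assoc, ← ENNReal.ofReal_mul (by positivity), ← mul_pow]
        congr 3
        field_simp

theorem hyperbolicVolume_eq_densityVolume : hyperbolicVolume d ϰ = densityVolume d ϰ := by
  have hlim : ∀ f : ℝ → ℝ, ContinuousAt f 0 → f 0 = 1 →
      Filter.Tendsto (fun ε => ENNReal.ofReal (f ε ^ d)) (nhdsWithin 0 (Set.Ioi 0)) (nhds 1) :=
    fun f hf hf0 => by
      simpa [hf0] using
        (ENNReal.tendsto_ofReal (hf.pow d).tendsto).mono_left nhdsWithin_le_nhds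
  have hsmall : ∀ᶠ ε : ℝ in nhdsWithin 0 (Set.Ioi 0), ε ∈ Set.Ioc 0 (1 / 4) :=
    Ioc_mem_nhdsGT (by norm_num)
  refine le_antisymm
    (measure_le_of_tendsto_smul (hlim (fun ε => (1 + ε) / (1 - ε)) ?_ (by simp)) ?_)
    (measure_le_of_tendsto_smul (hlim (fun ε => (1 + ε) ^ 2 / (1 - ε)) ?_ (by simp)) ?_)
  · exact ContinuousAt.div (by fun_prop) (by fun_prop) (by simp)
  · exact hsmall.mono fun ε hε => measure_le_of_locally_le fun p => ⟨relBall p ε,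
      isOpen_relBall p ε, mem_relBall_self p hε.1, fun A hA hAm =>
        hyperbolicVolume_le_of_subset_relBall hε.1 (by linarith [hε.2]) hA hAm⟩
  · exact ContinuousAt.div (by fun_prop) (by fun_prop) (by simp)
  · exact hsmall.mono fun ε hε => measure_le_of_locally_le fun p => ⟨relBall p ε,
      isOpen_relBall p ε, mem_relBall_self p hε.1, fun A hA hAm =>
        densityVolume_le_of_subset_relBall hε.1 hε.2 hA hAm⟩

end HyperbolicSpace

/-! ### Splitting off the last coordinate -/

section JoinLast

variable {m : ℕ}

/-- The point of `ℝ^{m+1}` with last coordinate `p.1` and remaining coordinates `p.2`. The last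
coordinate comes first in the pair, as the outer variable of iterated integrals. -/
noncomputable def joinLast (p : ℝ × EuclideanSpace ℝ (Fin m)) : EuclideanSpace ℝ (Fin (m + 1)) :=
  WithLp.toLp 2 (Fin.snoc (α := fun _ => ℝ) p.2 p.1)

@[simp]
theorem joinLast_last (p : ℝ × EuclideanSpace ℝ (Fin m)) : joinLast p (Fin.last m) = p.1 := by
  simp [joinLast]

@[simp]
theorem joinLast_castSucc (p : ℝ × EuclideanSpace ℝ (Fin m)) (i : Fin m) :
    joinLast p i.castSucc = p.2 i := by
  simp [joinLast]

theorem joinLast_sub (p q : ℝ × EuclideanSpace ℝ (Fin m)) :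
    joinLast p - joinLast q = joinLast (p - q) := by
  ext i
  refine Fin.lastCases ?_ (fun i => ?_) i <;> simp

theorem inner_joinLast (p q : ℝ × EuclideanSpace ℝ (Fin m)) :
    inner ℝ (joinLast p) (joinLast q) = p.1 * q.1 + inner ℝ p.2 q.2 := by
  simp [PiLp.inner_apply, Fin.sum_univ_castSucc, mul_comm, add_comm]

theorem norm_joinLast_sq (p : ℝ × EuclideanSpace ℝ (Fin m)) :
    ‖joinLast p‖ ^ 2 = p.1 ^ 2 + ‖p.2‖ ^ 2 := by
  rw [← real_inner_self_eq_norm_sq, inner_joinLast, real_inner_self_eq_norm_sq, ← sq]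

theorem measurePreserving_joinLast :
    MeasurePreserving (joinLast (m := m)) (volume : Measure (ℝ × EuclideanSpace ℝ (Fin m)))
      volume := by
  have hpi := (MeasurePreserving.id (volume : Measure ℝ)).prod
    (EuclideanSpace.volume_preserving_symm_measurableEquiv_toLp (Fin m))
  have hsnoc := (volume_preserving_piFinSuccAbove (fun _ : Fin (m + 1) => ℝ) (Fin.last m)).symm
  have htoLp := (EuclideanSpace.volume_preserving_symm_measurableEquiv_toLp (Fin (m + 1))).symm
  convert! htoLp.comp (hsnoc.comp hpi) using 1
  ext p i
  refine Fin.lastCases ?_ (fun i => ?_) i <;> simp [MeasurableEquiv.piFinSuccAbove]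

theorem measurable_joinLast : Measurable (joinLast (m := m)) :=
  measurePreserving_joinLast.measurable

theorem lintegral_eq_lintegral_joinLast {f : EuclideanSpace ℝ (Fin (m + 1)) → ℝ≥0∞}
    (hf : Measurable f) :
    ∫⁻ x, f x = ∫⁻ y : ℝ, ∫⁻ w : EuclideanSpace ℝ (Fin m), f (joinLast (y, w)) := by
  rw [← measurePreserving_joinLast.lintegral_comp hf, Measure.volume_eq_prod]
  exact lintegral_prod _ (hf.comp measurable_joinLast).aemeasurable

end JoinLast

/-! ### Substitutions -/

theorem lintegral_Ioi_inv_mul_eq_lintegral_exp {k : ℝ} (hk : 0 < k) (g : ℝ → ℝ≥0∞) :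
    ∫⁻ y in Set.Ioi (0 : ℝ), ENNReal.ofReal y⁻¹ * g y = ∫⁻ s : ℝ, g (k * Real.exp s) := by
  have himg : (fun s : ℝ => k * Real.exp s) '' Set.univ = Set.Ioi 0 := by
    rw [← Set.image_const_mul_Ioi_zero hk, ← Real.range_exp, ← Set.range_comp, Set.image_univ]
    rfl
  have hinj : Function.Injective fun s : ℝ => k * Real.exp s :=
    (mul_right_injective₀ hk.ne').comp Real.exp_injective
  rw [← himg, lintegral_image_eq_lintegral_abs_deriv_mul MeasurableSet.univ
    (fun s _ => ((Real.hasDerivAt_exp s).const_mul k).hasDerivWithinAt) hinj.injOn,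
    Measure.restrict_univ]
  refine lintegral_congr fun s => ?_
  have hpos : 0 < k * Real.exp s := mul_pos hk (Real.exp_pos s)
  rw [abs_of_pos hpos, ← mul_assoc, ← ENNReal.ofReal_mul hpos.le, mul_inv_cancel₀ hpos.ne',
    ENNReal.ofReal_one, one_mul]

theorem lintegral_inv_sqrt_mul_eq_lintegral_sinh {k : ℝ} (hk : 0 < k) (g : ℝ → ℝ≥0∞) :
    ∫⁻ y : ℝ, ENNReal.ofReal (√(y ^ 2 + k ^ 2))⁻¹ * g y = ∫⁻ s : ℝ, g (Real.sinh s * k) := by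
  have himg : (fun s : ℝ => Real.sinh s * k) '' Set.univ = Set.univ := by
    rw [Set.image_univ, Set.range_eq_univ]
    exact (mul_right_surjective₀ hk.ne').comp Real.sinh_surjective
  have hinj : Function.Injective fun s : ℝ => Real.sinh s * k :=
    (mul_left_injective₀ hk.ne').comp Real.sinh_injective
  rw [← setLIntegral_univ, ← himg, lintegral_image_eq_lintegral_abs_deriv_mul MeasurableSet.univ
    (fun s _ => ((Real.hasDerivAt_sinh s).mul_const k).hasDerivWithinAt) hinj.injOn,
    Measure.restrict_univ]
  refine lintegral_congr fun s => ?_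
  have hpos : 0 < Real.cosh s * k := mul_pos (Real.cosh_pos s) hk
  have hsqrt : √((Real.sinh s * k) ^ 2 + k ^ 2) = Real.cosh s * k := by
    rw [← Real.sqrt_sq hpos.le, mul_pow, mul_pow, Real.cosh_sq]
    ring_nf
  rw [hsqrt, abs_of_pos hpos, ← mul_assoc, ← ENNReal.ofReal_mul hpos.le,
    mul_inv_cancel₀ hpos.ne', ENNReal.ofReal_one, one_mul]

theorem lintegral_Ioi_inv_sqrt_mul_eq_lintegral_sinh (g : ℝ → ℝ≥0∞) :
    ∫⁻ y in Set.Ioi (0 : ℝ), ENNReal.ofReal (√(1 + y ^ 2))⁻¹ * g y =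
      ∫⁻ s in Set.Ioi (0 : ℝ), g (Real.sinh s) := by
  have hsubst := lintegral_inv_sqrt_mul_eq_lintegral_sinh one_pos ((Set.Ioi 0).indicator g)
  simp only [one_pow, mul_one, add_comm _ (1 : ℝ)] at hsubst
  rw [← lintegral_indicator measurableSet_Ioi, ← lintegral_indicator measurableSet_Ioi]
  simp only [Set.indicator_mul_right]
  rw [hsubst]
  exact lintegral_congr fun s => by simp only [Set.indicator_apply, Set.mem_Ioi, Real.sinh_pos_iff]

theorem lintegral_eq_lintegral_add_smul {E : Type*} [NormedAddCommGroup E] [NormedSpace ℝ E]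
    [MeasurableSpace E] [BorelSpace E] [FiniteDimensional ℝ E] (μ : Measure E)
    [μ.IsAddHaarMeasure] {y : ℝ} (hy : 0 < y) (a : E) {g : E → ℝ≥0∞} (hg : Measurable g) :
    ∫⁻ w, g w ∂μ = ENNReal.ofReal (y ^ Module.finrank ℝ E) * ∫⁻ w, g (a + y • w) ∂μ := by
  have hmap : ∫⁻ w, g (a + y • w) ∂μ = ∫⁻ w, g (a + w) ∂(μ.map (y • ·)) :=
    (lintegral_map (hg.comp (measurable_const_add a)) (measurable_const_smul y)).symm
  rw [hmap, Measure.map_addHaar_smul μ hy.ne', lintegral_smul_measure,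
    lintegral_add_left_eq_self, smul_eq_mul, ← mul_assoc, ← ENNReal.ofReal_mul (by positivity),
    abs_of_pos (by positivity), mul_inv_cancel₀ (by positivity), ENNReal.ofReal_one, one_mul]

/-! ### Hyperboloid coordinates -/

namespace HyperbolicSpace

theorem lintegral_hyperbolicVolume_comp_point {d : ℕ} [NeZero d] {ϰ : ℝ} [Fact (0 < ϰ)]
    {g : EuclideanSpace ℝ (Fin d) → ℝ≥0∞} (hg : Measurable g) :
    ∫⁻ x, g x.point ∂hyperbolicVolume d ϰ =
      ∫⁻ x in {x | 0 < heightForm d x}, volumeDensity ϰ d x * g x := by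
  have hhalf : MeasurableSet {x | 0 < heightForm d x} :=
    measurableSet_lt measurable_const (heightForm d).measurable
  rw [hyperbolicVolume_eq_densityVolume, densityVolume,
    ← lintegral_map hg measurableEmbedding_point.measurable, measurableEmbedding_point.map_comap,
    range_point, restrict_withDensity hhalf,
    lintegral_withDensity_eq_lintegral_mul _ measurable_volumeDensity hg]
  simp only [Pi.mul_apply]

variable {m : ℕ} {ϰ : ℝ}

@[simp]
theorem heightForm_joinLast (p : ℝ × EuclideanSpace ℝ (Fin m)) :
    heightForm (m + 1) (joinLast p) = p.1 := joinLast_last p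

/-- The coordinates other than the height. -/
noncomputable def base (x : HyperbolicSpace (m + 1) ϰ) : EuclideanSpace ℝ (Fin m) :=
  WithLp.toLp 2 fun i => x.point i.castSucc

theorem point_eq_joinLast (x : HyperbolicSpace (m + 1) ϰ) :
    x.point = joinLast (x.height, x.base) := by
  ext i
  refine Fin.lastCases ?_ (fun i => ?_) i
  · rw [joinLast_last]
    rfl
  · rw [joinLast_castSucc]
    rfl

theorem norm_point_sub_point_sq (x y : HyperbolicSpace (m + 1) ϰ) :
    ‖x.point - y.point‖ ^ 2 = (x.height - y.height) ^ 2 + ‖x.base - y.base‖ ^ 2 := by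
  rw [point_eq_joinLast, point_eq_joinLast, joinLast_sub, norm_joinLast_sq]
  rfl

/-- The point with given height and base. -/
noncomputable def ofHeightBase (ϰ : ℝ) (y : ℝ) (hy : 0 < y) (w : EuclideanSpace ℝ (Fin m)) :
    HyperbolicSpace (m + 1) ϰ :=
  ⟨joinLast (y, w), (joinLast_last (y, w)).symm ▸ hy⟩

@[simp]
theorem height_ofHeightBase {y : ℝ} (hy : 0 < y) (w : EuclideanSpace ℝ (Fin m)) :
    (ofHeightBase ϰ y hy w).height = y := joinLast_last (y, w)

@[simp]
theorem base_ofHeightBase {y : ℝ} (hy : 0 < y) (w : EuclideanSpace ℝ (Fin m)) :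
    (ofHeightBase ϰ y hy w).base = w := by
  ext i
  exact joinLast_castSucc (y, w) i

/-- The space part of the hyperboloid coordinates centred at `o`; the time coordinate is then
`√(1 + ‖hyperboloidMap o x‖ ^ 2)`. -/
noncomputable def hyperboloidMap (o x : HyperbolicSpace (m + 1) ϰ) :
    EuclideanSpace ℝ (Fin (m + 1)) :=
  joinLast ((‖x.base - o.base‖ ^ 2 + x.height ^ 2 - o.height ^ 2) / (2 * o.height * x.height),
    (x.height)⁻¹ • (x.base - o.base))

theorem sqrt_one_add_norm_hyperboloidMap_sq (o x : HyperbolicSpace (m + 1) ϰ) :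
    √(1 + ‖hyperboloidMap o x‖ ^ 2) =
      (‖x.base - o.base‖ ^ 2 + x.height ^ 2 + o.height ^ 2) / (2 * o.height * x.height) := by
  have ho := o.height_pos
  have hx := x.height_pos
  rw [Real.sqrt_eq_iff_mul_self_eq (by positivity) (by positivity), hyperboloidMap,
    norm_joinLast_sq, norm_smul, Real.norm_of_nonneg (by positivity)]
  field_simp
  ring

theorem cosh_unitDist_eq_hyperboloidMap (o x z : HyperbolicSpace (m + 1) ϰ) :
    Real.cosh (unitDist x z) =
      √(1 + ‖hyperboloidMap o x‖ ^ 2) * √(1 + ‖hyperboloidMap o z‖ ^ 2) -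
        inner ℝ (hyperboloidMap o x) (hyperboloidMap o z) := by
  have ho := o.height_pos
  have hx := x.height_pos
  have hz := z.height_pos
  have hbase : ‖x.base - z.base‖ ^ 2 = ‖x.base - o.base‖ ^ 2 -
      2 * inner ℝ (x.base - o.base) (z.base - o.base) + ‖z.base - o.base‖ ^ 2 := by
    rw [← norm_sub_sq_real, sub_sub_sub_cancel_right]
  rw [cosh_unitDist, sqrt_one_add_norm_hyperboloidMap_sq, sqrt_one_add_norm_hyperboloidMap_sq,
    hyperboloidMap, hyperboloidMap, inner_joinLast, real_inner_smul_left, real_inner_smul_right,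
    norm_point_sub_point_sq, hbase]
  field_simp
  ring

theorem hyperboloidMap_self (o : HyperbolicSpace (m + 1) ϰ) : hyperboloidMap o o = 0 := by
  rw [← norm_eq_zero, ← sq_eq_zero_iff, hyperboloidMap, norm_joinLast_sq]
  simp

theorem cosh_unitDist_origin (o x : HyperbolicSpace (m + 1) ϰ) :
    Real.cosh (unitDist o x) = √(1 + ‖hyperboloidMap o x‖ ^ 2) := by
  rw [cosh_unitDist_eq_hyperboloidMap o o x, hyperboloidMap_self]
  simp

theorem norm_hyperboloidMap (o x : HyperbolicSpace (m + 1) ϰ) :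
    ‖hyperboloidMap o x‖ = Real.sinh (unitDist o x) := by
  have hsinh := Real.sinh_nonneg_iff.2 (unitDist_nonneg o x)
  rw [← pow_left_inj₀ (norm_nonneg _) hsinh two_ne_zero, Real.sinh_sq, cosh_unitDist_origin,
    Real.sq_sqrt (by positivity), add_sub_cancel_left]

/-- The point at signed distance `s` along the vertical geodesic through `o`, displaced by `w` in
the orthogonal direction (in hyperboloid coordinates). -/
noncomputable def cylinderPoint (o : HyperbolicSpace (m + 1) ϰ) (s : ℝ)
    (w : EuclideanSpace ℝ (Fin m)) : HyperbolicSpace (m + 1) ϰ :=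
  ofHeightBase ϰ (o.height / √(1 + ‖w‖ ^ 2) * Real.exp s)
    (mul_pos (div_pos o.height_pos (Real.sqrt_pos.2 (by positivity))) (Real.exp_pos s))
    (o.base + (o.height / √(1 + ‖w‖ ^ 2) * Real.exp s) • w)

theorem hyperboloidMap_cylinderPoint (o : HyperbolicSpace (m + 1) ϰ) (s : ℝ)
    (w : EuclideanSpace ℝ (Fin m)) :
    hyperboloidMap o (cylinderPoint o s w) = joinLast (Real.sinh s * √(1 + ‖w‖ ^ 2), w) := by
  have ho := o.height_pos
  have hk : 0 < √(1 + ‖w‖ ^ 2) := Real.sqrt_pos.2 (by positivity)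
  have hw : ‖w‖ ^ 2 = √(1 + ‖w‖ ^ 2) ^ 2 - 1 := by
    rw [Real.sq_sqrt (by positivity), add_sub_cancel_left]
  rw [hyperboloidMap, cylinderPoint, height_ofHeightBase, base_ofHeightBase, add_sub_cancel_left]
  congr 2
  · rw [norm_smul, Real.norm_of_nonneg (by positivity), Real.sinh_eq, Real.exp_neg, mul_pow]
    generalize √(1 + ‖w‖ ^ 2) = k at *
    rw [hw]
    field_simp
    ring
  · rw [smul_smul, inv_mul_cancel₀ (by positivity), one_smul]

theorem volumeDensity_joinLast (y : ℝ) (w : EuclideanSpace ℝ (Fin m)) :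
    volumeDensity ϰ (m + 1) (joinLast (y, w)) = ENNReal.ofReal ((√ϰ * y)⁻¹ ^ (m + 1)) := by
  rw [volumeDensity, heightForm_joinLast]

variable [Fact (0 < ϰ)]

theorem measurable_hyperboloidMap (o : HyperbolicSpace (m + 1) ϰ) :
    Measurable (hyperboloidMap o) := by
  have hheight : Measurable (height : HyperbolicSpace (m + 1) ϰ → ℝ) :=
    ((heightForm (m + 1)).continuous.comp continuous_point).measurable
  have hbase : Measurable (base : HyperbolicSpace (m + 1) ϰ → EuclideanSpace ℝ (Fin m)) := by
    refine ((PiLp.continuous_toLp 2 _).comp (continuous_pi fun i => ?_)).measurable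
    exact (EuclideanSpace.proj (𝕜 := ℝ) i.castSucc).continuous.comp continuous_point
  unfold hyperboloidMap
  exact measurable_joinLast.comp (by fun_prop)

theorem lintegral_hyperbolicVolume_joinLast {g : EuclideanSpace ℝ (Fin (m + 1)) → ℝ≥0∞}
    (hg : Measurable g) :
    ∫⁻ x, g x.point ∂hyperbolicVolume (m + 1) ϰ =
      ∫⁻ y in Set.Ioi (0 : ℝ), ENNReal.ofReal ((√ϰ * y)⁻¹ ^ (m + 1)) *
        ∫⁻ w : EuclideanSpace ℝ (Fin m), g (joinLast (y, w)) := by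
  have hhalf : MeasurableSet {x | 0 < heightForm (m + 1) x} :=
    measurableSet_lt measurable_const (heightForm (m + 1)).measurable
  have hmeas : Measurable ({x | 0 < heightForm (m + 1) x}.indicator
      fun x => volumeDensity ϰ (m + 1) x * g x) := (measurable_volumeDensity.mul hg).indicator hhalf
  rw [lintegral_hyperbolicVolume_comp_point hg, ← lintegral_indicator hhalf,
    lintegral_eq_lintegral_joinLast hmeas, ← lintegral_indicator measurableSet_Ioi]
  refine lintegral_congr fun y => ?_
  have hmem (w : EuclideanSpace ℝ (Fin m)) :
      joinLast (y, w) ∈ {x | 0 < heightForm (m + 1) x} ↔ y ∈ Set.Ioi 0 := by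
    rw [Set.mem_ofPred_eq, heightForm_joinLast, Set.mem_Ioi]
  by_cases hy : y ∈ Set.Ioi 0
  · simp only [Set.indicator_of_mem, hmem, hy, volumeDensity_joinLast]
    exact lintegral_const_mul _ (hg.comp (measurable_joinLast.comp measurable_prodMk_left))
  · simp only [Set.indicator_of_notMem, hmem, hy, not_false_eq_true, lintegral_zero]

theorem lintegral_hyperbolicVolume_add_smul {g : EuclideanSpace ℝ (Fin (m + 1)) → ℝ≥0∞}
    (hg : Measurable g) (a : EuclideanSpace ℝ (Fin m)) :
    ∫⁻ x, g x.point ∂hyperbolicVolume (m + 1) ϰ =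
      ENNReal.ofReal ((√ϰ)⁻¹ ^ (m + 1)) * ∫⁻ w : EuclideanSpace ℝ (Fin m),
        ∫⁻ y in Set.Ioi (0 : ℝ), ENNReal.ofReal y⁻¹ * g (joinLast (y, a + y • w)) := by
  have hmeas : Measurable fun p : ℝ × EuclideanSpace ℝ (Fin m) =>
      ENNReal.ofReal p.1⁻¹ * g (joinLast (p.1, a + p.1 • p.2)) := by
    refine Measurable.mul (by fun_prop) (hg.comp (measurable_joinLast.comp ?_))
    exact measurable_fst.prodMk ((measurable_fst.smul measurable_snd).const_add _)
  rw [lintegral_hyperbolicVolume_joinLast hg, ← lintegral_lintegral_swap hmeas.aemeasurable,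
    ← lintegral_const_mul _ hmeas.lintegral_prod_right']
  refine setLIntegral_congr_fun measurableSet_Ioi fun y hy => ?_
  have hy : 0 < y := hy
  have hslice : Measurable fun w : EuclideanSpace ℝ (Fin m) => g (joinLast (y, w)) :=
    hg.comp (measurable_joinLast.comp measurable_prodMk_left)
  have hslice' : Measurable fun w : EuclideanSpace ℝ (Fin m) => g (joinLast (y, a + y • w)) :=
    hslice.comp ((measurable_const_smul y).const_add a)
  have hscale : (√ϰ * y)⁻¹ ^ (m + 1) * y ^ m = (√ϰ)⁻¹ ^ (m + 1) * y⁻¹ := by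
    rw [mul_inv, mul_pow, pow_succ y⁻¹, inv_pow y]
    field_simp
  simp only
  rw [lintegral_eq_lintegral_add_smul volume hy a hslice, finrank_euclideanSpace_fin,
    lintegral_const_mul _ hslice', ← mul_assoc, ← mul_assoc,
    ← ENNReal.ofReal_mul (by positivity), ← ENNReal.ofReal_mul (by positivity), hscale]

theorem lintegral_hyperbolicVolume_cylinderPoint (o : HyperbolicSpace (m + 1) ϰ)
    {f : HyperbolicSpace (m + 1) ϰ → ℝ≥0∞} (hf : Measurable f) :
    ∫⁻ x, f x ∂hyperbolicVolume (m + 1) ϰ =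
      ENNReal.ofReal ((√ϰ)⁻¹ ^ (m + 1)) *
        ∫⁻ w : EuclideanSpace ℝ (Fin m), ∫⁻ s : ℝ, f (cylinderPoint o s w) := by
  set g : EuclideanSpace ℝ (Fin (m + 1)) → ℝ≥0∞ := Function.extend point f 0
  have hg : Measurable g := measurableEmbedding_point.measurable_extend hf measurable_const
  have hgpoint (x : HyperbolicSpace (m + 1) ϰ) : g x.point = f x :=
    point_injective.extend_apply f 0 x
  simp only [← hgpoint]
  rw [lintegral_hyperbolicVolume_add_smul hg o.base]
  congr 1
  refine lintegral_congr fun w => ?_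
  exact lintegral_Ioi_inv_mul_eq_lintegral_exp
    (div_pos o.height_pos (Real.sqrt_pos.2 (by positivity))) _

end HyperbolicSpace

theorem lintegral_inv_sqrt_norm_mul_eq_lintegral_joinLast {m : ℕ}
    {g : EuclideanSpace ℝ (Fin (m + 1)) → ℝ≥0∞} (hg : Measurable g) :
    ∫⁻ x, ENNReal.ofReal (√(1 + ‖x‖ ^ 2))⁻¹ * g x =
      ∫⁻ w : EuclideanSpace ℝ (Fin m), ∫⁻ s : ℝ,
        g (joinLast (Real.sinh s * √(1 + ‖w‖ ^ 2), w)) := by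
  have hmeas : Measurable fun x : EuclideanSpace ℝ (Fin (m + 1)) =>
      ENNReal.ofReal (√(1 + ‖x‖ ^ 2))⁻¹ * g x := Measurable.mul (by fun_prop) hg
  rw [lintegral_eq_lintegral_joinLast hmeas, lintegral_lintegral_swap
    (f := fun y w => ENNReal.ofReal (√(1 + ‖joinLast (y, w)‖ ^ 2))⁻¹ * g (joinLast (y, w)))
    (hmeas.comp measurable_joinLast).aemeasurable]
  refine lintegral_congr fun w => ?_
  have hnorm (y : ℝ) : 1 + ‖joinLast (y, w)‖ ^ 2 = y ^ 2 + √(1 + ‖w‖ ^ 2) ^ 2 := by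
    rw [norm_joinLast_sq, Real.sq_sqrt (by positivity), add_left_comm]
  simp only [hnorm]
  exact lintegral_inv_sqrt_mul_eq_lintegral_sinh (Real.sqrt_pos.2 (by positivity)) _

theorem HyperbolicSpace.lintegral_comp_hyperboloidMap {m : ℕ} {ϰ : ℝ} [Fact (0 < ϰ)]
    (o : HyperbolicSpace (m + 1) ϰ) {g : EuclideanSpace ℝ (Fin (m + 1)) → ℝ≥0∞}
    (hg : Measurable g) :
    ∫⁻ x, g (hyperboloidMap o x) ∂hyperbolicVolume (m + 1) ϰ =
      ENNReal.ofReal ((√ϰ)⁻¹ ^ (m + 1)) * ∫⁻ x, ENNReal.ofReal (√(1 + ‖x‖ ^ 2))⁻¹ * g x := by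
  rw [lintegral_hyperbolicVolume_cylinderPoint o (f := fun x => g (hyperboloidMap o x))
    (hg.comp (measurable_hyperboloidMap o)), lintegral_inv_sqrt_norm_mul_eq_lintegral_joinLast hg]
  simp only [hyperboloidMap_cylinderPoint]

/-! ### Polar coordinates and the volume of lenses -/

theorem lintegral_fun_norm_addHaar {E : Type*} [NormedAddCommGroup E] [NormedSpace ℝ E]
    [MeasurableSpace E] [BorelSpace E] [FiniteDimensional ℝ E] [Nontrivial E] (μ : Measure E)
    [μ.IsAddHaarMeasure] {f : ℝ → ℝ≥0∞} (hf : Measurable f) :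
    ∫⁻ x, f ‖x‖ ∂μ = Module.finrank ℝ E * μ (Metric.ball 0 1) *
      ∫⁻ y in Set.Ioi (0 : ℝ), ENNReal.ofReal (y ^ (Module.finrank ℝ E - 1)) * f y := by
  have hfsnd : Measurable fun p : Metric.sphere (0 : E) 1 × Set.Ioi (0 : ℝ) => f p.2 :=
    hf.comp (measurable_subtype_coe.comp measurable_snd)
  calc ∫⁻ x, f ‖x‖ ∂μ = ∫⁻ x : ({(0)}ᶜ : Set E), f ‖x.1‖ ∂(μ.comap (↑)) := by
        rw [lintegral_subtype_comap (measurableSet_singleton _).compl fun x => f ‖x‖,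
          restrict_compl_singleton]
    _ = ∫⁻ p, f p.2 ∂μ.toSphere.prod (.volumeIoiPow (Module.finrank ℝ E - 1)) := by
        rw [← μ.measurePreserving_homeomorphUnitSphereProd.lintegral_comp hfsnd]
        simp only [homeomorphUnitSphereProd_apply_snd_coe]
    _ = μ.toSphere Set.univ *
          ∫⁻ y : Set.Ioi (0 : ℝ), f y ∂Measure.volumeIoiPow (Module.finrank ℝ E - 1) := by
        rw [lintegral_prod _ hfsnd.aemeasurable]
        dsimp only
        rw [lintegral_const, mul_comm]
    _ = _ := by
        rw [μ.toSphere_apply_univ, Measure.volumeIoiPow,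
          lintegral_withDensity_eq_lintegral_mul _ (by fun_prop)
            (show Measurable fun y : Set.Ioi (0 : ℝ) => f y from hf.comp measurable_subtype_coe)]
        congr 1
        exact lintegral_subtype_comap measurableSet_Ioi
          fun y => ENNReal.ofReal (y ^ (Module.finrank ℝ E - 1)) * f y

theorem unitSphereArea_pos {k : ℕ} (hk : k ≠ 0) : 0 < unitSphereArea k := by
  have := Real.Gamma_pos_of_pos (show (0 : ℝ) < (k : ℝ) / 2 by positivity)
  rw [unitSphereArea]
  positivity

theorem unitBallVolume_pos {k : ℕ} (hk : k ≠ 0) : 0 < unitBallVolume k :=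
  div_pos (unitSphereArea_pos hk) (by positivity)

theorem volume_ball_eq_unitBallVolume {m : ℕ} (hm : m ≠ 0) (r : ℝ) :
    volume (Metric.ball (0 : EuclideanSpace ℝ (Fin m)) r) =
      ENNReal.ofReal (unitBallVolume m) * ENNReal.ofReal r ^ m := by
  have : Nonempty (Fin m) := Fin.pos_iff_nonempty.1 (Nat.pos_of_ne_zero hm)
  have hgamma : Real.Gamma ((m : ℝ) / 2) ≠ 0 := (Real.Gamma_pos_of_pos (by positivity)).ne'
  rw [EuclideanSpace.volume_ball, Fintype.card_fin, mul_comm, unitBallVolume, unitSphereArea,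
    Real.Gamma_add_one (by positivity), Real.sqrt_eq_rpow, ← Real.rpow_natCast,
    ← Real.rpow_mul Real.pi_pos.le, one_div_mul_eq_div]
  congr 2
  field_simp

theorem HyperbolicSpace.lintegral_fun_unitDist {m : ℕ} {ϰ : ℝ} [Fact (0 < ϰ)]
    (o : HyperbolicSpace (m + 1) ϰ) {f : ℝ → ℝ≥0∞} (hf : Measurable f) :
    ∫⁻ x, f (unitDist o x) ∂hyperbolicVolume (m + 1) ϰ =
      ENNReal.ofReal ((√ϰ)⁻¹ ^ (m + 1) * unitSphereArea (m + 1)) *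
        ∫⁻ r in Set.Ioi (0 : ℝ), ENNReal.ofReal (Real.sinh r ^ m) * f r := by
  have hfarsinh : Measurable (f ∘ Real.arsinh) := hf.comp Real.continuous_arsinh.measurable
  have hnorm (x : HyperbolicSpace (m + 1) ϰ) :
      f (unitDist o x) = (f ∘ Real.arsinh) ‖hyperboloidMap o x‖ := by
    rw [norm_hyperboloidMap, Function.comp_apply, Real.arsinh_sinh]
  have harea : (↑(m + 1) : ℝ≥0∞) * volume (Metric.ball (0 : EuclideanSpace ℝ (Fin (m + 1))) 1) =
      ENNReal.ofReal (unitSphereArea (m + 1)) := by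
    rw [volume_ball_eq_unitBallVolume m.succ_ne_zero, ENNReal.ofReal_one, one_pow, mul_one,
      ← ENNReal.ofReal_natCast, ← ENNReal.ofReal_mul (by positivity), unitBallVolume,
      mul_div_cancel₀ _ (by positivity)]
  have hsubst := lintegral_Ioi_inv_sqrt_mul_eq_lintegral_sinh
    fun y => ENNReal.ofReal (y ^ m) * f (Real.arsinh y)
  simp only [Real.arsinh_sinh, mul_left_comm (ENNReal.ofReal _⁻¹)] at hsubst
  simp only [hnorm]
  rw [lintegral_comp_hyperboloidMap o (g := fun y => (f ∘ Real.arsinh) ‖y‖)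
      (hfarsinh.comp measurable_norm),
    lintegral_fun_norm_addHaar volume
      (f := fun y => ENNReal.ofReal (√(1 + y ^ 2))⁻¹ * (f ∘ Real.arsinh) y)
      (Measurable.mul (by fun_prop) hfarsinh),
    finrank_euclideanSpace_fin, harea, Nat.add_sub_cancel, ← mul_assoc,
    ← ENNReal.ofReal_mul (by positivity), ← hsubst]
  rfl

/-- The image of a lens `radialLens o x` in hyperboloid coordinates centred at `o`, where `r` is the
distance of `o` and `x` (for curvature `-1`) and `v` is the image of `x`. -/
def hyperboloidLens {E : Type*} [NormedAddCommGroup E] [InnerProductSpace ℝ E] (r : ℝ) (v : E) :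
    Set E :=
  {y | √(1 + ‖y‖ ^ 2) < Real.cosh r ∧
    Real.cosh r * √(1 + ‖y‖ ^ 2) - inner ℝ v y < Real.cosh r}

namespace HyperbolicSpace

variable {m : ℕ} {ϰ : ℝ} [Fact (0 < ϰ)]

theorem dist_lt_dist_iff_cosh {d : ℕ} [NeZero d] {a b c e : HyperbolicSpace d ϰ} :
    dist a b < dist c e ↔ Real.cosh (unitDist a b) < Real.cosh (unitDist c e) := by
  have hϰ : 0 < ϰ := Fact.out
  rw [Real.cosh_lt_cosh, abs_of_nonneg (unitDist_nonneg _ _), abs_of_nonneg (unitDist_nonneg _ _),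
    unitDist_eq_sqrt_mul_dist, unitDist_eq_sqrt_mul_dist,
    mul_lt_mul_iff_right₀ (Real.sqrt_pos.2 hϰ)]

theorem radialLens_eq_preimage_hyperboloidLens (o x : HyperbolicSpace (m + 1) ϰ) :
    radialLens o x =
      hyperboloidMap o ⁻¹' hyperboloidLens (unitDist o x) (hyperboloidMap o x) := by
  ext z
  rw [mem_radialLens, dist_lt_dist_iff_cosh, dist_lt_dist_iff_cosh, cosh_unitDist_origin o z,
    cosh_unitDist_eq_hyperboloidMap o x z, ← cosh_unitDist_origin o x]
  rfl

end HyperbolicSpace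

section HyperboloidLens

variable {E : Type*} [NormedAddCommGroup E] [InnerProductSpace ℝ E]

theorem isOpen_hyperboloidLens (r : ℝ) (v : E) : IsOpen (hyperboloidLens r v) :=
  IsOpen.inter (isOpen_lt (f := fun y : E => √(1 + ‖y‖ ^ 2)) (by fun_prop) continuous_const)
    (isOpen_lt (f := fun y : E => Real.cosh r * √(1 + ‖y‖ ^ 2) - inner ℝ v y) (by fun_prop)
      continuous_const)

theorem measurable_indicator_hyperboloidLens [MeasurableSpace E] [BorelSpace E] (r : ℝ) (v : E) :
    Measurable ((hyperboloidLens r v).indicator (1 : E → ℝ≥0∞)) :=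
  measurable_one.indicator (isOpen_hyperboloidLens r v).measurableSet

theorem lintegral_hyperboloidLens_eq_of_norm_eq [FiniteDimensional ℝ E] [MeasurableSpace E]
    [BorelSpace E] (r : ℝ) {v v' : E} (h : ‖v‖ = ‖v'‖) :
    ∫⁻ y, ENNReal.ofReal (√(1 + ‖y‖ ^ 2))⁻¹ * (hyperboloidLens r v).indicator 1 y =
      ∫⁻ y, ENNReal.ofReal (√(1 + ‖y‖ ^ 2))⁻¹ * (hyperboloidLens r v').indicator 1 y := by
  set R := Submodule.reflection (Submodule.span ℝ {v - v'})ᗮ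
  have hRv : R v = v' := Submodule.reflection_sub h
  have hmeas : Measurable fun y => ENNReal.ofReal (√(1 + ‖y‖ ^ 2))⁻¹ *
      (hyperboloidLens r v').indicator (1 : E → ℝ≥0∞) y :=
    Measurable.mul (by fun_prop) (measurable_indicator_hyperboloidLens r v')
  have hpre (y : E) : y ∈ hyperboloidLens r v ↔ R y ∈ hyperboloidLens r v' := by
    simp only [hyperboloidLens, Set.mem_ofPred_eq, R.norm_map, ← hRv, R.inner_map_map]
  rw [← R.measurePreserving.lintegral_comp hmeas]
  exact lintegral_congr fun y =>
    congr_arg₂ _ (by rw [R.norm_map]) (Set.indicator_eq_indicator (hpre y) rfl)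

end HyperboloidLens

/-- The squared radius of the section, at position `s` along its axis, of the lens between two
points at distance `r`. Nonpositive values stand for an empty section. -/
noncomputable def lensSection (r s : ℝ) : ℝ :=
  (Real.cosh r / max (Real.cosh s) (Real.cosh (r - s))) ^ 2 - 1

theorem joinLast_mem_hyperboloidLens_iff {m : ℕ} {r s : ℝ} {w : EuclideanSpace ℝ (Fin m)} :
    joinLast (Real.sinh s * √(1 + ‖w‖ ^ 2), w) ∈ hyperboloidLens r (joinLast (Real.sinh r, 0)) ↔
      w ∈ Metric.ball 0 √(lensSection r s) := by
  have hnorm : 1 + ‖joinLast (Real.sinh s * √(1 + ‖w‖ ^ 2), w)‖ ^ 2 =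
      (√(1 + ‖w‖ ^ 2) * Real.cosh s) ^ 2 := by
    rw [norm_joinLast_sq, mul_pow, mul_pow, Real.cosh_sq, Real.sq_sqrt (by positivity)]
    ring
  have hinner : inner ℝ (joinLast (Real.sinh r, (0 : EuclideanSpace ℝ (Fin m))))
      (joinLast (Real.sinh s * √(1 + ‖w‖ ^ 2), w)) =
        Real.sinh r * (Real.sinh s * √(1 + ‖w‖ ^ 2)) := by
    rw [inner_joinLast, inner_zero_left, add_zero]
  have hball : w ∈ Metric.ball 0 √(lensSection r s) ↔
      √(1 + ‖w‖ ^ 2) < Real.cosh r / max (Real.cosh s) (Real.cosh (r - s)) := by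
    have := Real.cosh_pos r
    have : 0 < max (Real.cosh s) (Real.cosh (r - s)) := lt_max_of_lt_left (Real.cosh_pos s)
    rw [mem_ball_zero_iff, Real.lt_sqrt (norm_nonneg w), lensSection, lt_sub_iff_add_lt',
      Real.sqrt_lt' (by positivity)]
  have hk : 0 < √(1 + ‖w‖ ^ 2) := Real.sqrt_pos.2 (by positivity)
  rw [hball, hyperboloidLens, Set.mem_ofPred_eq, hnorm, hinner]
  generalize √(1 + ‖w‖ ^ 2) = k at hk ⊢
  have hsub : Real.cosh r * (k * Real.cosh s) - Real.sinh r * (Real.sinh s * k) =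
      k * Real.cosh (r - s) := by
    rw [Real.cosh_sub]
    ring
  rw [Real.sqrt_sq (mul_pos hk (Real.cosh_pos s)).le, hsub,
    lt_div_iff₀ (lt_max_of_lt_left (Real.cosh_pos s)), mul_max_of_nonneg _ _ hk.le, max_lt_iff]

theorem continuous_lensSection (r : ℝ) : Continuous (lensSection r) :=
  ((continuous_const.div (by fun_prop) fun s =>
    (lt_max_of_lt_left (Real.cosh_pos s)).ne').pow 2).sub continuous_const

theorem lintegral_hyperboloidLens {m : ℕ} (hm : m ≠ 0) (r : ℝ)
    {v : EuclideanSpace ℝ (Fin (m + 1))} (hv : ‖v‖ = |Real.sinh r|) :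
    ∫⁻ y, ENNReal.ofReal (√(1 + ‖y‖ ^ 2))⁻¹ * (hyperboloidLens r v).indicator 1 y =
      ENNReal.ofReal (unitBallVolume m) *
        ∫⁻ s : ℝ, ENNReal.ofReal √(lensSection r s) ^ m := by
  set axis : EuclideanSpace ℝ (Fin (m + 1)) := joinLast (Real.sinh r, 0) with haxis
  have hnorm : ‖v‖ = ‖axis‖ := by
    rw [hv, ← pow_left_inj₀ (abs_nonneg _) (norm_nonneg _) two_ne_zero, haxis, norm_joinLast_sq,
      sq_abs, norm_zero, zero_pow two_ne_zero, add_zero]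
  have hlens := measurable_indicator_hyperboloidLens r axis
  have hcoord : Measurable fun p : EuclideanSpace ℝ (Fin m) × ℝ =>
      joinLast (Real.sinh p.2 * √(1 + ‖p.1‖ ^ 2), p.1) :=
    measurable_joinLast.comp (by fun_prop)
  have hsection (s : ℝ) : ∫⁻ w : EuclideanSpace ℝ (Fin m), (hyperboloidLens r axis).indicator
        1 (joinLast (Real.sinh s * √(1 + ‖w‖ ^ 2), w)) =
      ENNReal.ofReal (unitBallVolume m) * ENNReal.ofReal √(lensSection r s) ^ m := by
    rw [← volume_ball_eq_unitBallVolume hm,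
      ← lintegral_indicator_one Metric.isOpen_ball.measurableSet]
    exact lintegral_congr fun w => Set.indicator_eq_indicator joinLast_mem_hyperboloidLens_iff rfl
  have hradius : Measurable fun s => ENNReal.ofReal √(lensSection r s) ^ m :=
    (continuous_lensSection r).measurable.sqrt.ennreal_ofReal.pow_const m
  rw [lintegral_hyperboloidLens_eq_of_norm_eq r hnorm,
    lintegral_inv_sqrt_norm_mul_eq_lintegral_joinLast hlens,
    lintegral_lintegral_swap (f := fun w s => (hyperboloidLens r axis).indicator 1
      (joinLast (Real.sinh s * √(1 + ‖w‖ ^ 2), w))) (hlens.comp hcoord).aemeasurable]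
  simp only [hsection]
  exact lintegral_const_mul _ hradius

/-- The integrand of the volume of a lens, as it appears in the formula for the expected degree. -/
noncomputable def lensIntegrand (m : ℕ) (r t : ℝ) : ℝ :=
  (Real.cosh r ^ 2 / Real.cosh (r - t) ^ 2 - 1) ^ ((m : ℝ) / 2)

/-- The volume of the half of a lens on the side of one centre, as a function of the distance `r` of
the two centres, up to a constant factor. -/
noncomputable def lensIntegral (m : ℕ) (r : ℝ) : ℝ :=
  ∫ t in (0 : ℝ)..(r / 2), lensIntegrand m r t

theorem lensSection_sub (r s : ℝ) : lensSection r (r - s) = lensSection r s := by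
  rw [lensSection, lensSection, sub_sub_cancel, max_comm]

theorem lensSection_nonpos {r s : ℝ} (hr : 0 ≤ r) (hs : s ≤ 0) : lensSection r s ≤ 0 := by
  have hmax : 0 < max (Real.cosh s) (Real.cosh (r - s)) := lt_max_of_lt_left (Real.cosh_pos s)
  have hcosh : Real.cosh r ≤ Real.cosh (r - s) := by
    rw [Real.cosh_le_cosh, abs_of_nonneg hr, abs_of_nonneg (by linarith)]
    linarith
  rw [lensSection, sub_nonpos]
  exact pow_le_one₀ (div_nonneg (Real.cosh_pos r).le hmax.le)
    ((div_le_one hmax).2 (hcosh.trans (le_max_right _ _)))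

theorem lensSection_eq {r s : ℝ} (hs : 0 ≤ s) (hsr : s ≤ r / 2) :
    lensSection r s = Real.cosh r ^ 2 / Real.cosh (r - s) ^ 2 - 1 := by
  rw [lensSection, max_eq_right, div_pow]
  rw [Real.cosh_le_cosh, abs_of_nonneg hs, abs_of_nonneg (by linarith)]
  linarith

theorem one_le_cosh_sq_div_cosh_sq {r t : ℝ} (ht : 0 ≤ t) (htr : t ≤ r / 2) :
    1 ≤ Real.cosh r ^ 2 / Real.cosh (r - t) ^ 2 := by
  rw [one_le_div (pow_pos (Real.cosh_pos _) 2)]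
  refine pow_le_pow_left₀ (Real.cosh_pos _).le ?_ 2
  rw [Real.cosh_le_cosh, abs_of_nonneg (by linarith), abs_of_nonneg (by linarith)]
  linarith

theorem lensIntegrand_nonneg (m : ℕ) {r t : ℝ} (ht : 0 ≤ t) (htr : t ≤ r / 2) :
    0 ≤ lensIntegrand m r t :=
  Real.rpow_nonneg (sub_nonneg.2 (one_le_cosh_sq_div_cosh_sq ht htr)) _

theorem ofReal_sqrt_lensSection_pow {m : ℕ} {r s : ℝ} (hs : 0 ≤ s) (hsr : s ≤ r / 2) :
    ENNReal.ofReal √(lensSection r s) ^ m = ENNReal.ofReal (lensIntegrand m r s) := by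
  rw [← ENNReal.ofReal_pow (Real.sqrt_nonneg _), lensSection_eq hs hsr, Real.sqrt_eq_rpow,
    ← Real.rpow_natCast, ← Real.rpow_mul (sub_nonneg.2 (one_le_cosh_sq_div_cosh_sq hs hsr)),
    one_div_mul_eq_div, lensIntegrand]

theorem continuous_lensIntegrand (m : ℕ) :
    Continuous fun p : ℝ × ℝ => lensIntegrand m p.1 p.2 := by
  unfold lensIntegrand
  refine Continuous.rpow_const ?_ fun p => Or.inr (by positivity)
  exact (Continuous.div (by fun_prop) (by fun_prop) fun p =>
    (pow_pos (Real.cosh_pos _) 2).ne').sub continuous_const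

theorem intervalIntegrable_lensIntegrand (m : ℕ) (r a b : ℝ) :
    IntervalIntegrable (lensIntegrand m r) volume a b :=
  ((continuous_lensIntegrand m).comp (Continuous.prodMk_right r)).intervalIntegrable a b

theorem setLIntegral_Ioi_half_eq_setLIntegral_Iic {f : ℝ → ℝ≥0∞} {r : ℝ}
    (hf : ∀ s, f (r - s) = f s) :
    ∫⁻ s in Set.Ioi (r / 2), f s = ∫⁻ s in Set.Iic (r / 2), f s := by
  rw [← lintegral_indicator measurableSet_Ioi, ← lintegral_sub_left_eq_self _ r,
    setLIntegral_congr Iio_ae_eq_Iic.symm, ← lintegral_indicator measurableSet_Iio]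
  refine lintegral_congr fun s => ?_
  simp only [Set.indicator_apply, Set.mem_Ioi, Set.mem_Iio, hf, lt_sub_comm, sub_half]

theorem lintegral_lensSection {m : ℕ} (hm : m ≠ 0) {r : ℝ} (hr : 0 ≤ r) :
    ∫⁻ s : ℝ, ENNReal.ofReal √(lensSection r s) ^ m =
      2 * ENNReal.ofReal (lensIntegral m r) := by
  set f : ℝ → ℝ≥0∞ := fun s => ENNReal.ofReal √(lensSection r s) ^ m with hf
  have hsymm (s : ℝ) : f (r - s) = f s := by simp only [hf, lensSection_sub]
  have hzero (s : ℝ) (hs : s ∈ Set.Iic 0) : f s = 0 := by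
    simp only [hf, Real.sqrt_eq_zero_of_nonpos (lensSection_nonpos hr hs), ENNReal.ofReal_zero,
      zero_pow hm]
  have hhalf : ∫⁻ s in Set.Iic (r / 2), f s = ENNReal.ofReal (lensIntegral m r) := by
    rw [← Set.Iic_union_Ioc_eq_Iic (by positivity : (0 : ℝ) ≤ r / 2),
      lintegral_union measurableSet_Ioc (Set.Iic_disjoint_Ioc le_rfl),
      setLIntegral_congr_fun measurableSet_Iic hzero, lintegral_zero, zero_add, lensIntegral,
      intervalIntegral.integral_of_le (by positivity), ofReal_integral_eq_lintegral_ofReal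
        (intervalIntegrable_lensIntegrand m r 0 (r / 2)).1
        (ae_restrict_of_forall_mem measurableSet_Ioc fun s hs =>
          lensIntegrand_nonneg m hs.1.le hs.2)]
    exact setLIntegral_congr_fun measurableSet_Ioc fun s hs =>
      ofReal_sqrt_lensSection_pow hs.1.le hs.2
  rw [← lintegral_add_compl f (measurableSet_Iic (a := r / 2)), Set.compl_Iic,
    setLIntegral_Ioi_half_eq_setLIntegral_Iic hsymm, hhalf, two_mul]

theorem HyperbolicSpace.hyperbolicVolume_radialLens {m : ℕ} (hm : m ≠ 0) {ϰ : ℝ} [Fact (0 < ϰ)]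
    (o x : HyperbolicSpace (m + 1) ϰ) :
    hyperbolicVolume (m + 1) ϰ (radialLens o x) =
      ENNReal.ofReal ((√ϰ)⁻¹ ^ (m + 1) * unitBallVolume m * 2 * lensIntegral m (unitDist o x)) := by
  have hball := (unitBallVolume_pos hm).le
  have hopen : IsOpen (radialLens o x) := Metric.isOpen_ball.inter Metric.isOpen_ball
  have hnorm : ‖hyperboloidMap o x‖ = |Real.sinh (unitDist o x)| := by
    rw [norm_hyperboloidMap, abs_of_nonneg (Real.sinh_nonneg_iff.2 (unitDist_nonneg o x))]
  calc hyperbolicVolume (m + 1) ϰ (radialLens o x)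
      = ∫⁻ z, (hyperboloidLens (unitDist o x) (hyperboloidMap o x)).indicator 1
          (hyperboloidMap o z) ∂hyperbolicVolume (m + 1) ϰ := by
        rw [← lintegral_indicator_one hopen.measurableSet,
          radialLens_eq_preimage_hyperboloidLens]
        rfl
    _ = ENNReal.ofReal ((√ϰ)⁻¹ ^ (m + 1)) * (ENNReal.ofReal (unitBallVolume m) *
          (2 * ENNReal.ofReal (lensIntegral m (unitDist o x)))) := by
        rw [lintegral_comp_hyperboloidMap o (measurable_indicator_hyperboloidLens _ _),
          lintegral_hyperboloidLens hm _ hnorm, lintegral_lensSection hm (unitDist_nonneg o x)]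
    _ = _ := by
        rw [ENNReal.ofReal_mul (by positivity), ENNReal.ofReal_mul (by positivity),
          ENNReal.ofReal_mul (by positivity), ENNReal.ofReal_ofNat, mul_assoc, mul_assoc]

/-! ### Growth of the lens integral -/

theorem continuous_lensIntegral (m : ℕ) : Continuous (lensIntegral m) :=
  intervalIntegral.continuous_parametric_intervalIntegral_of_continuous
    (continuous_lensIntegrand m) (continuous_id.div_const 2)

theorem lensIntegral_nonneg (m : ℕ) {r : ℝ} (hr : 0 ≤ r) : 0 ≤ lensIntegral m r :=
  intervalIntegral.integral_nonneg (by linarith) fun _ ht => lensIntegrand_nonneg m ht.1 ht.2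

theorem exp_half_le_cosh_div_cosh {r t : ℝ} (htr : t ≤ r) :
    Real.exp t / 2 ≤ Real.cosh r / Real.cosh (r - t) := by
  have hadd : Real.exp t * Real.exp (r - t) = Real.exp r := by
    rw [← Real.exp_add, add_sub_cancel]
  have hsub : Real.exp t * Real.exp (-(r - t)) ≤ Real.exp r := by
    rw [← Real.exp_add, Real.exp_le_exp]
    linarith
  rw [le_div_iff₀ (Real.cosh_pos _), Real.cosh_eq, Real.cosh_eq]
  linarith [Real.exp_pos (-r)]

theorem sqrt_sub_one_le_rpow_half {b p : ℝ} (hb : 0 ≤ b) (hp : 1 ≤ p) :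
    √b - 1 ≤ b ^ (p / 2) := by
  rcases le_total b 1 with hb1 | hb1
  · linarith [Real.sqrt_le_one.2 hb1, Real.rpow_nonneg hb (p / 2)]
  · have : √b ≤ b ^ (p / 2) := by
      rw [Real.sqrt_eq_rpow]
      exact Real.rpow_le_rpow_of_exponent_le hb1 (by linarith)
    linarith

theorem le_lensIntegrand {m : ℕ} (hm : m ≠ 0) {r t : ℝ} (ht : 0 ≤ t) (htr : t ≤ r / 2) :
    (t - 3) / 2 ≤ lensIntegrand m r t := by
  set q := Real.cosh r / Real.cosh (r - t) with hq
  have hq1 : 1 ≤ q ^ 2 := by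
    rw [hq, div_pow]
    exact one_le_cosh_sq_div_cosh_sq ht htr
  have hexp : Real.exp t / 2 ≤ q := exp_half_le_cosh_div_cosh (by linarith)
  have hsqrt : q - 1 ≤ √(q ^ 2 - 1) := by
    have : 0 ≤ q := by positivity
    have : 1 ≤ q := by nlinarith
    exact Real.le_sqrt_of_sq_le (by nlinarith)
  calc (t - 3) / 2 ≤ Real.exp t / 2 - 2 := by linarith [Real.add_one_le_exp t]
    _ ≤ √(q ^ 2 - 1) - 1 := by linarith
    _ ≤ (q ^ 2 - 1) ^ ((m : ℝ) / 2) :=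
        sqrt_sub_one_le_rpow_half (by linarith) (by exact_mod_cast Nat.one_le_iff_ne_zero.2 hm)
    _ = lensIntegrand m r t := by rw [hq, div_pow, lensIntegrand]

theorem le_lensIntegral {m : ℕ} (hm : m ≠ 0) {r : ℝ} (hr : 0 ≤ r) :
    r ^ 2 / 16 - 3 * r / 4 ≤ lensIntegral m r := by
  have hlower : ∫ t in (0 : ℝ)..(r / 2), (t - 3) / 2 = r ^ 2 / 16 - 3 * r / 4 := by
    rw [intervalIntegral.integral_div, intervalIntegral.integral_sub (by simp) (by simp),
      integral_id, intervalIntegral.integral_const, smul_eq_mul]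
    ring
  rw [← hlower]
  refine intervalIntegral.integral_mono_on (by linarith)
    (Continuous.intervalIntegrable (by fun_prop) _ _)
    (intervalIntegrable_lensIntegrand m r _ _) fun t ht => le_lensIntegrand hm ht.1 ht.2

theorem sinh_le_exp (x : ℝ) : Real.sinh x ≤ Real.exp x := by
  linarith [Real.cosh_add_sinh x, Real.cosh_pos x]

theorem sinh_pow_le_exp_mul (m : ℕ) {x : ℝ} (hx : 0 ≤ x) :
    Real.sinh x ^ m ≤ Real.exp (m * x) := by
  rw [Real.exp_nat_mul]
  exact pow_le_pow_left₀ (Real.sinh_nonneg_iff.2 hx) (sinh_le_exp x) m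

theorem exp_mul_sinh_pow_mul_exp_lensIntegral_le {m : ℕ} (hm : m ≠ 0) {c r : ℝ} (hc : 0 < c)
    (hr : 0 ≤ r) (A : ℝ) :
    Real.exp (A * r) * (Real.sinh r ^ m * Real.exp (-(c * lensIntegral m r))) ≤
      Real.exp (4 * (A + m + 1 + 3 * c / 4) ^ 2 / c) * Real.exp (-r) := by
  set B := A + m + 1 + 3 * c / 4 with hB
  have hlens : c * (r ^ 2 / 16 - 3 * r / 4) ≤ c * lensIntegral m r := by
    gcongr
    exact le_lensIntegral hm hr
  have hsquare : B * r - c * r ^ 2 / 16 ≤ 4 * B ^ 2 / c := by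
    have hnonneg : 0 ≤ c / 16 * (r - 8 * B / c) ^ 2 := by positivity
    have hexpand : c / 16 * (r - 8 * B / c) ^ 2 =
        4 * B ^ 2 / c - (B * r - c * r ^ 2 / 16) := by
      field_simp
      ring
    linarith
  calc Real.exp (A * r) * (Real.sinh r ^ m * Real.exp (-(c * lensIntegral m r)))
      ≤ Real.exp (A * r) * (Real.exp (m * r) * Real.exp (-(c * lensIntegral m r))) := by
        gcongr
        exact sinh_pow_le_exp_mul m hr
    _ = Real.exp (A * r + m * r - c * lensIntegral m r) := by
        rw [← Real.exp_add, ← Real.exp_add]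
        ring_nf
    _ ≤ Real.exp (4 * B ^ 2 / c + -r) := by
        rw [Real.exp_le_exp]
        have : B * r = A * r + m * r + r + 3 * c * r / 4 := by
          rw [hB]
          ring
        linarith
    _ = Real.exp (4 * B ^ 2 / c) * Real.exp (-r) := Real.exp_add _ _

theorem rpow_neg_natCast_div_two {x : ℝ} (hx : 0 ≤ x) (d : ℕ) :
    x ^ (-(d : ℝ) / 2) = (√x)⁻¹ ^ d := by
  rw [Real.sqrt_eq_rpow, ← Real.rpow_neg hx, ← Real.rpow_natCast, ← Real.rpow_mul hx]
  ring_nf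

theorem expectedDegreeIntegrand_succ (m : ℕ) {ϰ : ℝ} (hϰ : 0 ≤ ϰ) (γ r : ℝ) :
    expectedDegreeIntegrand (m + 1) ϰ γ r = Real.sinh r ^ m *
      Real.exp (-(2 * γ * unitBallVolume m * (√ϰ)⁻¹ ^ (m + 1) * lensIntegral m r)) := by
  rw [expectedDegreeIntegrand, rpow_neg_natCast_div_two hϰ, Nat.add_sub_cancel]
  simp only [Nat.cast_succ, add_sub_cancel_right, lensIntegral, lensIntegrand]

theorem integrableOn_exp_mul_expectedDegreeIntegrand {m : ℕ} (hm : m ≠ 0) {ϰ γ : ℝ} (hϰ : 0 < ϰ)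
    (hγ : 0 < γ) (A : ℝ) :
    IntegrableOn (fun r => Real.exp (A * r) * expectedDegreeIntegrand (m + 1) ϰ γ r)
      (Set.Ioi 0) := by
  have := unitBallVolume_pos hm
  simp only [expectedDegreeIntegrand_succ m hϰ.le]
  set c := 2 * γ * unitBallVolume m * (√ϰ)⁻¹ ^ (m + 1)
  have hc : 0 < c := by positivity
  have hcont : Continuous fun r =>
      Real.exp (A * r) * (Real.sinh r ^ m * Real.exp (-(c * lensIntegral m r))) := by
    have := continuous_lensIntegral m
    fun_prop
  refine Integrable.mono' ((integrableOn_exp_neg_Ioi 0).const_mul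
    (Real.exp (4 * (A + m + 1 + 3 * c / 4) ^ 2 / c))) hcont.aestronglyMeasurable
    (ae_restrict_of_forall_mem measurableSet_Ioi fun r hr => ?_)
  have : 0 ≤ Real.sinh r := Real.sinh_nonneg_iff.2 (le_of_lt hr)
  rw [Real.norm_of_nonneg (by positivity)]
  exact exp_mul_sinh_pow_mul_exp_lensIntegral_le hm hc (le_of_lt hr) A

theorem expectedDegreeIntegrand_nonneg (d : ℕ) (ϰ γ : ℝ) {r : ℝ} (hr : 0 ≤ r) :
    0 ≤ expectedDegreeIntegrand d ϰ γ r :=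
  mul_nonneg (pow_nonneg (Real.sinh_nonneg_iff.2 hr) _) (Real.exp_pos _).le

theorem integrableOn_expectedDegreeIntegrand {m : ℕ} (hm : m ≠ 0) {ϰ γ : ℝ} (hϰ : 0 < ϰ)
    (hγ : 0 < γ) : IntegrableOn (expectedDegreeIntegrand (m + 1) ϰ γ) (Set.Ioi 0) := by
  simpa using integrableOn_exp_mul_expectedDegreeIntegrand hm hϰ hγ 0

theorem exists_pow_floor_le_exp {a : ℝ≥0∞} (ha : a ≠ ∞) :
    ∃ A : ℝ, ∀ t, 0 ≤ t → a ^ ⌊t⌋₊ ≤ ENNReal.ofReal (Real.exp (A * t)) := by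
  set b := max a.toReal 1
  have hb : 1 ≤ b := le_max_right _ _
  refine ⟨Real.log b, fun t ht => ?_⟩
  calc a ^ ⌊t⌋₊ ≤ ENNReal.ofReal b ^ ⌊t⌋₊ := by
        gcongr
        exact ENNReal.le_ofReal_iff_toReal_le ha (by positivity) |>.2 (le_max_left _ _)
    _ = ENNReal.ofReal (Real.exp (Real.log b * ⌊t⌋₊)) := by
        rw [← ENNReal.ofReal_pow (by positivity), mul_comm, Real.exp_nat_mul,
          Real.exp_log (by positivity)]
    _ ≤ ENNReal.ofReal (Real.exp (Real.log b * t)) := by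
        have := Real.log_nonneg hb
        gcongr
        exact Nat.floor_le ht

/-! ### The intensity measure on hyperbolic space -/

namespace HyperbolicSpace

instance nullSingletonClass_hyperbolicVolume {d : ℕ} [NeZero d] {ϰ : ℝ} [Fact (0 < ϰ)] :
    NullSingletonClass (hyperbolicVolume d ϰ) := by
  have hd : (0 : ℝ) < d := Nat.cast_pos.2 (Nat.pos_of_ne_zero (NeZero.ne d))
  have := Measure.nullSingletonClass_hausdorff (HyperbolicSpace d ϰ) hd
  refine ⟨fun x => ?_⟩
  rw [hyperbolicVolume, Measure.euclideanHausdorffMeasure_def, Measure.smul_apply,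
    measure_singleton, smul_zero]

variable {m : ℕ} {ϰ : ℝ} [Fact (0 < ϰ)]

theorem hyperbolicVolume_ball (o : HyperbolicSpace (m + 1) ϰ) (R : ℝ) :
    hyperbolicVolume (m + 1) ϰ (Metric.ball o R) =
      ENNReal.ofReal ((√ϰ)⁻¹ ^ (m + 1) * unitSphereArea (m + 1)) *
        ∫⁻ r in Set.Ioo 0 (√ϰ * R), ENNReal.ofReal (Real.sinh r ^ m) := by
  have hϰ : 0 < ϰ := Fact.out
  have hball : Metric.ball o R = unitDist o ⁻¹' Set.Iio (√ϰ * R) := by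
    ext x
    rw [Metric.mem_ball', Set.mem_preimage, Set.mem_Iio, unitDist_eq_sqrt_mul_dist,
      mul_lt_mul_iff_right₀ (Real.sqrt_pos.2 hϰ)]
  have hpolar := lintegral_fun_unitDist o (f := (Set.Iio (√ϰ * R)).indicator 1)
    (measurable_one.indicator measurableSet_Iio)
  have hindicator (r : ℝ) :
      ENNReal.ofReal (Real.sinh r ^ m) * (Set.Iio (√ϰ * R)).indicator 1 r =
        (Set.Iio (√ϰ * R)).indicator (fun r => ENNReal.ofReal (Real.sinh r ^ m)) r := by
    simp [Set.indicator_apply]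
  simp only [hindicator] at hpolar
  rw [setLIntegral_indicator measurableSet_Iio, Set.Iio_inter_Ioi] at hpolar
  rw [← hpolar, ← lintegral_indicator_one Metric.isOpen_ball.measurableSet, hball]
  rfl

theorem hyperbolicVolume_ball_le (o : HyperbolicSpace (m + 1) ϰ) {R : ℝ} (hR : 0 ≤ R) :
    hyperbolicVolume (m + 1) ϰ (Metric.ball o R) ≤
      ENNReal.ofReal ((√ϰ)⁻¹ ^ (m + 1) * unitSphereArea (m + 1)) *
        ENNReal.ofReal (Real.exp ((m + 1) * (√ϰ * R))) := by
  rw [hyperbolicVolume_ball]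
  gcongr
  set T := √ϰ * R
  have : 0 ≤ T := by positivity
  calc ∫⁻ r in Set.Ioo 0 T, ENNReal.ofReal (Real.sinh r ^ m)
      ≤ ∫⁻ _ in Set.Ioo 0 T, ENNReal.ofReal (Real.exp (m * T)) := by
        refine setLIntegral_mono measurable_const fun r hr => ENNReal.ofReal_le_ofReal ?_
        refine (sinh_pow_le_exp_mul m hr.1.le).trans ?_
        gcongr
        exact hr.2.le
    _ = ENNReal.ofReal (Real.exp (m * T) * T) := by
        rw [setLIntegral_const, Real.volume_Ioo, sub_zero, ← ENNReal.ofReal_mul (by positivity)]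
    _ ≤ ENNReal.ofReal (Real.exp ((m + 1) * T)) := by
        rw [add_one_mul, Real.exp_add]
        gcongr
        linarith [Real.add_one_le_exp T]

theorem hyperbolicVolume_ball_ne_zero (o : HyperbolicSpace (m + 1) ϰ) {R : ℝ} (hR : 0 < R) :
    hyperbolicVolume (m + 1) ϰ (Metric.ball o R) ≠ 0 := by
  have hϰ : 0 < ϰ := Fact.out
  have harea := unitSphereArea_pos m.succ_ne_zero
  have hsinh : ∫⁻ r in Set.Ioo 0 (√ϰ * R), ENNReal.ofReal (Real.sinh r ^ m) ≠ 0 := by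
    have hsupport : Set.Ioo 0 (√ϰ * R) ⊆
        Function.support fun r => ENNReal.ofReal (Real.sinh r ^ m) := fun r hr =>
      (ENNReal.ofReal_pos.2 (pow_pos (Real.sinh_pos_iff.2 hr.1) m)).ne'
    rw [← pos_iff_ne_zero, setLIntegral_pos_iff (by fun_prop),
      Set.inter_eq_right.2 hsupport, Real.volume_Ioo, ENNReal.ofReal_pos, sub_zero]
    positivity
  rw [hyperbolicVolume_ball]
  exact mul_ne_zero (ENNReal.ofReal_pos.2 (by positivity)).ne' hsinh

theorem exists_smul_hyperbolicVolume_ball_add_one_le (γ : ℝ) (o : HyperbolicSpace (m + 1) ϰ) :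
    ∃ C q : ℝ≥0∞, C ≠ ∞ ∧ q ≠ ∞ ∧ ∀ k : ℕ,
      (ENNReal.ofReal γ • hyperbolicVolume (m + 1) ϰ) (Metric.ball o (k + 1)) + 1 ≤
        C * q ^ k := by
  set q := ENNReal.ofReal (Real.exp ((m + 1) * √ϰ)) with hq
  set D := ENNReal.ofReal γ * ENNReal.ofReal ((√ϰ)⁻¹ ^ (m + 1) * unitSphereArea (m + 1))
  have hq1 : 1 ≤ q := ENNReal.one_le_ofReal.2 (Real.one_le_exp (by positivity))
  have hqk (k : ℕ) : ENNReal.ofReal (Real.exp ((m + 1) * (√ϰ * (k + 1)))) = q ^ (k + 1) := by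
    rw [hq, ← ENNReal.ofReal_pow (Real.exp_nonneg _), ← Real.exp_nat_mul, Nat.cast_succ]
    ring_nf
  refine ⟨(D + 1) * q, q, by finiteness, by finiteness, fun k => ?_⟩
  calc (ENNReal.ofReal γ • hyperbolicVolume (m + 1) ϰ) (Metric.ball o (k + 1)) + 1
      ≤ D * q ^ (k + 1) + q ^ (k + 1) := by
        rw [Measure.smul_apply, smul_eq_mul, ← hqk, mul_assoc]
        gcongr
        · exact hyperbolicVolume_ball_le o (by positivity)
        · rw [hqk]
          exact one_le_pow₀ hq1
    _ = (D + 1) * q * q ^ k := by ring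

theorem poissonLaw_radialLens (hm : m ≠ 0) {γ : ℝ} (hγ : 0 ≤ γ) (o x : HyperbolicSpace (m + 1) ϰ) :
    poissonLaw ((ENNReal.ofReal γ • hyperbolicVolume (m + 1) ϰ) (radialLens o x)) {0} =
      ENNReal.ofReal (Real.exp (-(2 * γ * unitBallVolume m * (√ϰ)⁻¹ ^ (m + 1) *
        lensIntegral m (unitDist o x)))) := by
  have := unitBallVolume_pos hm
  have := lensIntegral_nonneg m (unitDist_nonneg o x)
  rw [Measure.smul_apply, smul_eq_mul, hyperbolicVolume_radialLens hm, ← ENNReal.ofReal_mul hγ,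
    poissonLaw_singleton_zero ENNReal.ofReal_ne_top, ENNReal.toReal_ofReal (by positivity)]
  ring_nf

theorem lintegral_mul_poissonLaw_radialLens (hm : m ≠ 0) {γ : ℝ} (hγ : 0 ≤ γ)
    (o : HyperbolicSpace (m + 1) ϰ) {f : ℝ → ℝ≥0∞} (hf : Measurable f) :
    ∫⁻ x, f (unitDist o x) *
        poissonLaw ((ENNReal.ofReal γ • hyperbolicVolume (m + 1) ϰ) (radialLens o x)) {0}
          ∂(ENNReal.ofReal γ • hyperbolicVolume (m + 1) ϰ) =
      ENNReal.ofReal (γ * unitSphereArea (m + 1) * (√ϰ)⁻¹ ^ (m + 1)) *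
        ∫⁻ r in Set.Ioi (0 : ℝ),
          f r * ENNReal.ofReal (expectedDegreeIntegrand (m + 1) ϰ γ r) := by
  have hϰ : 0 < ϰ := Fact.out
  have hvoid : Measurable fun r => ENNReal.ofReal
      (Real.exp (-(2 * γ * unitBallVolume m * (√ϰ)⁻¹ ^ (m + 1) * lensIntegral m r))) := by
    have := continuous_lensIntegral m
    fun_prop
  simp only [poissonLaw_radialLens hm hγ]
  rw [lintegral_smul_measure, lintegral_fun_unitDist o (f := fun r => f r * ENNReal.ofReal
      (Real.exp (-(2 * γ * unitBallVolume m * (√ϰ)⁻¹ ^ (m + 1) * lensIntegral m r))))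
      (hf.mul hvoid), smul_eq_mul, ← mul_assoc,
    ← ENNReal.ofReal_mul hγ, mul_comm ((√ϰ)⁻¹ ^ (m + 1)), mul_assoc γ]
  congr 1
  refine setLIntegral_congr_fun measurableSet_Ioi fun r hr => ?_
  have := pow_nonneg (Real.sinh_nonneg_iff.2 (le_of_lt hr)) m
  simp only [expectedDegreeIntegrand_succ m hϰ.le, ENNReal.ofReal_mul this]
  ring

theorem setLIntegral_poissonLaw_radialLens (hm : m ≠ 0) {γ : ℝ} (hγ : 0 < γ)
    (o : HyperbolicSpace (m + 1) ϰ) :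
    ∫⁻ x in {o}ᶜ,
        poissonLaw ((ENNReal.ofReal γ • hyperbolicVolume (m + 1) ϰ) (radialLens o x)) {0}
          ∂(ENNReal.ofReal γ • hyperbolicVolume (m + 1) ϰ) =
      ENNReal.ofReal (γ * unitSphereArea (m + 1) * ϰ ^ (-((m + 1 : ℕ) : ℝ) / 2) *
        ∫ r in Set.Ioi (0 : ℝ), expectedDegreeIntegrand (m + 1) ϰ γ r) := by
  have hϰ : 0 < ϰ := Fact.out
  have := unitSphereArea_pos m.succ_ne_zero
  have hpolar := lintegral_mul_poissonLaw_radialLens hm hγ.le o (f := 1) measurable_one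
  simp only [Pi.one_apply, one_mul] at hpolar
  rw [Measure.restrict_smul, restrict_compl_singleton, hpolar, rpow_neg_natCast_div_two hϰ.le,
    ENNReal.ofReal_mul (p := γ * unitSphereArea (m + 1) * (√ϰ)⁻¹ ^ (m + 1)) (by positivity),
    ofReal_integral_eq_lintegral_ofReal (integrableOn_expectedDegreeIntegrand hm hϰ hγ)
      (ae_restrict_of_forall_mem measurableSet_Ioi fun r hr =>
        expectedDegreeIntegrand_nonneg _ ϰ γ (le_of_lt hr))]

theorem setLIntegral_pow_mul_poissonLaw_radialLens_ne_top (hm : m ≠ 0) {γ : ℝ} (hγ : 0 < γ)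
    (o : HyperbolicSpace (m + 1) ϰ) {a : ℝ≥0∞} (ha : a ≠ ∞) :
    ∫⁻ x in {o}ᶜ, a ^ ⌊dist o x⌋₊ *
        poissonLaw ((ENNReal.ofReal γ • hyperbolicVolume (m + 1) ϰ) (radialLens o x)) {0}
          ∂(ENNReal.ofReal γ • hyperbolicVolume (m + 1) ϰ) ≠ ∞ := by
  have hϰ : 0 < ϰ := Fact.out
  obtain ⟨A, hA⟩ := exists_pow_floor_le_exp ha
  have hpow (x : HyperbolicSpace (m + 1) ϰ) :
      a ^ ⌊dist o x⌋₊ ≤ ENNReal.ofReal (Real.exp (A / √ϰ * unitDist o x)) := by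
    convert! hA _ dist_nonneg using 3
    rw [unitDist_eq_sqrt_mul_dist, ← mul_assoc, div_mul_cancel₀ _ (Real.sqrt_pos.2 hϰ).ne']
  refine ne_top_of_le_ne_top ?_ ((setLIntegral_le_lintegral _ _).trans
    (lintegral_mono fun x => mul_le_mul_left (hpow x) _))
  rw [lintegral_mul_poissonLaw_radialLens hm hγ.le o
    (f := fun r => ENNReal.ofReal (Real.exp (A / √ϰ * r))) (by fun_prop)]
  simp only [← ENNReal.ofReal_mul (Real.exp_pos _).le]
  exact ENNReal.mul_ne_top ENNReal.ofReal_ne_top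
    (integrableOn_exp_mul_expectedDegreeIntegrand hm hϰ hγ _).lintegral_lt_top.ne

end HyperbolicSpace

/-! ### Separated points -/

namespace HyperbolicSpace

variable {m : ℕ} {ϰ : ℝ} [Fact (0 < ϰ)]

theorem dist_lt_dist_of_height_eq {o x y : HyperbolicSpace (m + 1) ϰ} (hxo : x.height ≤ o.height)
    (hxy : y.height = x.height)
    (h : x.height * (o.height ^ 2 + ‖o.base - x.base‖ ^ 2) < o.height * ‖x.base - y.base‖ ^ 2) :
    dist o x < dist x y := by
  have ho := o.height_pos
  have hx := x.height_pos
  have hheight : (o.height - x.height) ^ 2 ≤ o.height ^ 2 :=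
    pow_le_pow_left₀ (sub_nonneg.2 hxo) (by linarith) 2
  rw [dist_lt_dist_iff_cosh, cosh_unitDist, cosh_unitDist, norm_point_sub_point_sq,
    norm_point_sub_point_sq, hxy, sub_self, add_lt_add_iff_left,
    div_lt_div_iff₀ (by positivity) (by positivity)]
  calc ((o.height - x.height) ^ 2 + ‖o.base - x.base‖ ^ 2) * (2 * x.height * x.height)
      = x.height * ((o.height - x.height) ^ 2 + ‖o.base - x.base‖ ^ 2) * (2 * x.height) := by
        ring
    _ ≤ x.height * (o.height ^ 2 + ‖o.base - x.base‖ ^ 2) * (2 * x.height) := by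
        gcongr
    _ < o.height * ‖x.base - y.base‖ ^ 2 * (2 * x.height) := by gcongr
    _ = (0 ^ 2 + ‖x.base - y.base‖ ^ 2) * (2 * o.height * x.height) := by ring

-- Near the boundary hyperplane, distances between points of a common height blow up faster than
-- their distances to `o`, so equally spaced points of a small height are separated.
theorem exists_separated_points (hm : m ≠ 0) (o : HyperbolicSpace (m + 1) ϰ) (n : ℕ) :
    ∃ p : Fin n → HyperbolicSpace (m + 1) ϰ,
      (∀ i j, i ≠ j → dist o (p i) < dist (p i) (p j)) ∧ ∀ i, p i ≠ o := by
  have ho := o.height_pos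
  set δ : ℝ := ((n : ℝ) ^ 2 + 2)⁻¹ with hδ
  have : 0 < δ := by positivity
  have hδn : δ * (1 + (n : ℝ) ^ 2) < 1 := by
    rw [hδ, inv_mul_lt_one₀ (by positivity)]
    linarith
  have hδ1 : δ < 1 := inv_lt_one_of_one_lt₀ (by nlinarith [sq_nonneg (n : ℝ)])
  set e : EuclideanSpace ℝ (Fin m) := EuclideanSpace.single ⟨0, Nat.pos_of_ne_zero hm⟩ 1 with he
  have henorm : ‖e‖ = 1 := by rw [he, PiLp.norm_single, norm_one]
  have hheight : o.height * δ < o.height := mul_lt_of_lt_one_right ho hδ1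
  refine ⟨fun i => ofHeightBase ϰ (o.height * δ) (by positivity)
    (o.base + (o.height * (i : ℝ)) • e), fun i j hij => ?_, fun i hi => ?_⟩
  · have hgap : (1 : ℝ) ≤ ((i : ℝ) - (j : ℝ)) ^ 2 := by
      have hsub : ((i : ℕ) : ℤ) - ((j : ℕ) : ℤ) ≠ 0 :=
        sub_ne_zero.2 (by exact_mod_cast fun h => hij (Fin.ext h))
      exact_mod_cast sq_pos_of_ne_zero hsub
    have hi : ((i : ℕ) : ℝ) ^ 2 ≤ (n : ℝ) ^ 2 := by
      gcongr
      exact i.2.le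
    refine dist_lt_dist_of_height_eq (by simpa using hheight.le) (by simp) ?_
    simp only [height_ofHeightBase, base_ofHeightBase]
    rw [sub_add_cancel_left, add_sub_add_left_eq_sub, ← sub_smul, norm_neg, norm_smul, norm_smul,
      henorm, mul_one, mul_one, Real.norm_eq_abs, Real.norm_eq_abs, sq_abs, sq_abs]
    calc o.height * δ * (o.height ^ 2 + (o.height * (i : ℝ)) ^ 2)
        = o.height ^ 3 * (δ * (1 + (i : ℝ) ^ 2)) := by ring
      _ ≤ o.height ^ 3 * (δ * (1 + (n : ℝ) ^ 2)) := by gcongr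
      _ < o.height ^ 3 * 1 := by gcongr
      _ ≤ o.height ^ 3 * ((i : ℝ) - (j : ℝ)) ^ 2 := by gcongr
      _ = o.height * (o.height * (i : ℝ) - o.height * (j : ℝ)) ^ 2 := by ring
  · exact hheight.ne (by simpa using congrArg height hi)

end HyperbolicSpace

theorem theorem1p1 (d : ℕ) [NeZero d] (hd : 2 ≤ d) (ϰ : ℝ) [Fact (0 < ϰ)] (γ : ℝ) (hγ : 0 < γ)
    (o : HyperbolicSpace d ϰ)
    {Ω : Type*} [MeasurableSpace Ω] (P : Measure Ω) [IsProbabilityMeasure P]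
    (η : Ω → Set (HyperbolicSpace d ϰ))
    (hη : IsPoissonProcess η (ENNReal.ofReal γ • hyperbolicVolume d ϰ) P) :
    Measurable (fun ω => originDegree o (η ω)) ∧
    (∀ n : ℕ, ∫⁻ ω, (originDegree o (η ω) : ℝ≥0∞) ^ n ∂P < ∞) ∧
    (IntegrableOn (expectedDegreeIntegrand d ϰ γ) (Set.Ioi 0) ∧
      ∫⁻ ω, (originDegree o (η ω) : ℝ≥0∞) ∂P =
        ENNReal.ofReal (γ * unitSphereArea d * ϰ ^ (-(d : ℝ) / 2) *
          ∫ r in Set.Ioi (0 : ℝ), expectedDegreeIntegrand d ϰ γ r)) ∧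
    (∀ n : ℕ, 0 < P {ω | (n : ℕ∞) ≤ originDegree o (η ω)}) := by
  obtain ⟨m, rfl⟩ : ∃ m, d = m + 1 := ⟨d - 1, by lia⟩
  have hm : m ≠ 0 := by lia
  have hϰ : 0 < ϰ := Fact.out
  refine ⟨hη.measurable_originDegree o, fun n => ?_,
    ⟨integrableOn_expectedDegreeIntegrand hm hϰ hγ, ?_⟩, fun n => ?_⟩
  · obtain ⟨C, q, hC, hq, hball⟩ := HyperbolicSpace.exists_smul_hyperbolicVolume_ball_add_one_le γ o
    exact hη.lintegral_originDegree_pow_lt_top o hC hq hball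
      (fun a ha => HyperbolicSpace.setLIntegral_pow_mul_poissonLaw_radialLens_ne_top hm hγ o ha) n
  · rw [hη.lintegral_originDegree, HyperbolicSpace.setLIntegral_poissonLaw_radialLens hm hγ]
  · obtain ⟨p, hsep, hpo⟩ := HyperbolicSpace.exists_separated_points hm o n
    refine hη.measure_le_originDegree_pos (fun x r hr => ?_) hsep hpo
    rw [Measure.smul_apply, smul_eq_mul]
    exact mul_ne_zero (ENNReal.ofReal_pos.2 hγ).ne'
      (HyperbolicSpace.hyperbolicVolume_ball_ne_zero x hr)
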